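/- Let $d\ge 1$, let $\mathcal M$ be the space of probability measures on $\{e\in\mathbb Z^d:|e|=1\}$ ($|\cdot|$ is the Euclidean norm) and $\Omega=\mathcal M^{\mathbb Z^d}$ the space of environments $\omega=(\omega(x,e))_{x\in\mathbb{Z}^d,|e|=1}$. For $\omega\in\Omega$ let $P_\omega^x$ be the law on $(\mathbb Z^d)^{\mathbb N}$ of the Markov chain $(X_n)_{n\ge0}$ with $X_0=x$ and $P_\omega^x(X_{n+1}=y+e\mid X_n=y)=\omega(y,e)$. Let $P$ be a probability measure on $\Omega$, stationary under the shifts of $\mathbb Z^d$, and let $\mathbf P=P\otimes P_\omega^{o}$ be the joint law of the environment and the walk started at the origin $o$. Write $\omega_x=\omega(x,\cdot)$, let $d(\cdot,\cdot)$ be the $\ell^1$-distance and $\mathcal F_\Lambda=\sigma(\omega_x:x\in\Lambda)$. Assume: 1. (Uniform ellipticity) there is $\kappa\in(0,\tfrac1{2d})$ such that $P$-a.s. $\omega(o,e)>\kappa$ for all $e\in\mathbb{Z}^d$ with $|e|=1$. 2. ($r$-Markov property) $r\ge1$ is an integer such that for every finite $V\subset\mathbb Z^d$, $P((\omega_x)_{x\in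 V}\in\cdot\mid\mathcal F_{V^c})=P((\omega_x)_{x\in V}\in\cdot\mid\mathcal F_{\partial_rV})$ $P$-a.s., where $\partial_rV=\{x\in\mathbb{Z}^d\setminus V:d(x,V)\le r\}$. 3. (Mixing condition $(*)$) there are constants $\gamma,C\in(0,\infty)$ such that for all finite $\Delta\subset V\subset\mathbb Z^d$ with $d(\Delta,V^c)\ge r$ and all $A\subset V^c$, $$\frac{\mathrm dP((\omega_x)_{x\in\Delta}\in\cdot\mid\eta)}{\mathrm dP((\omega_x)_{x\in\Delta}\in\cdot\mid\eta')}\le\exp\Big(C\sum_{x\in A,\,y\in\Delta}e^{-\gamma d(x,y)}\Big)$$ for $P$-almost all pairs of configurations $\eta,\eta'\in\mathcal M^{V^c}$ that agree on $V^c\setminus A$ (that is, for all such pairs taken from some set of configurations of full $P$-measure). Here $P((\omega_x)_{x\in\Delta}\in\cdot\mid\eta)$ is the regular conditional law of $(\omega_x)_{x\in\Delta}$ given $(\omega_x)_{x\in V^c}=\eta$, and the bound includes that the first law is absolutely continuous with respect to the second. Let $e_1$ be the first vector of the natural basis, $\mathcal H_j=\{x\in\mathbb Z^d:x\cdot e_1=X_0\cdot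 e_1+j\}$ for $j\ge0$, $D=\inf\{n\ge1:X_n\cdot e_1\le X_0\cdot e_1\}$ and, for $c>0$, $$R(c)=\inf\Big\{n\ge0:\sum_{i=0}^n1_{X_i\in\mathcal H_j}>c\,(j+1)^2\text{ for some }j\ge0\Big\}\wedge D,\qquad \inf\emptyset=\infty.$$ If $\mathbf P\big(\varlimsup_{n\to\infty}X_n\cdot e_1/n>0\big)>0$, then there is a constant $c_5>0$, depending only on $d$ and $P$, such that $\mathbf P(R(c_5)=\infty)>0$. In other words, with positive probability the walk never returns to a level $\le X_0\cdot e_1$ after time $0$ and, for every $j\ge0$, visits $\mathcal H_j$ at most $c_5(j+1)^2$ times. -/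

import Mathlib

open MeasureTheory ProbabilityTheory Filter
open scoped ENNReal

namespace RWRE

/-- The lattice `ℤ^d`. -/
abbrev Site (d : ℕ) : Type := Fin d → ℤ

/-- The `2d` lattice vectors of Euclidean norm `1`. -/
abbrev Dir (d : ℕ) : Type := {e : Site d // ∑ i, (e i) ^ 2 = 1}

instance instFiniteDir (d : ℕ) : Finite (Dir d) := by
  have h : ∀ (e : Dir d) (i : Fin d), e.1 i ∈ Set.Icc (-1 : ℤ) 1 := by
    intro e i
    have h1 : (e.1 i) ^ 2 ≤ ∑ j, (e.1 j) ^ 2 :=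
      Finset.single_le_sum (f := fun j => (e.1 j) ^ 2) (fun j _ => sq_nonneg _) (Finset.mem_univ i)
    rw [e.2] at h1
    constructor <;> nlinarith
  refine Finite.of_injective
    (fun (e : Dir d) (i : Fin d) => (⟨e.1 i, h e i⟩ : Set.Icc (-1 : ℤ) 1)) ?_
  intro e e' hee
  apply Subtype.ext
  funext i
  exact congrArg Subtype.val (congrFun hee i)

noncomputable instance instFintypeDir (d : ℕ) : Fintype (Dir d) := Fintype.ofFinite _

instance instNonemptyDir (d : ℕ) [NeZero d] : Nonempty (Dir d) :=
  ⟨⟨Pi.single 0 1, by simp [Pi.single_apply]⟩⟩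

/-- The space of probability measures on the finite set `Dir d`, as probability vectors
with the Borel σ-algebra. -/
abbrev TransProb (d : ℕ) : Type := stdSimplex ℝ (Dir d)

instance instStandardBorelTransProb (d : ℕ) : StandardBorelSpace (TransProb d) :=
  (isClosed_stdSimplex ℝ (Dir d)).measurableSet.standardBorel

instance instNonemptyTransProb (d : ℕ) [NeZero d] : Nonempty (TransProb d) := by
  classical
  exact ⟨⟨_, single_mem_stdSimplex ℝ (Classical.arbitrary (Dir d))⟩⟩

/-- Environments: `(ω x).1 e` is the probability `ω(x, e)` of jumping from `x` to `x + e`. -/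
abbrev Env (d : ℕ) : Type := Site d → TransProb d

/-- Restriction of an environment to the sites of `Λ`. -/
def restrictEnv {d : ℕ} (Λ : Set (Site d)) (ω : Env d) : Λ → TransProb d := fun x => ω x

lemma measurable_restrictEnv {d : ℕ} (Λ : Set (Site d)) : Measurable (restrictEnv Λ) :=
  measurable_pi_lambda _ fun x => measurable_pi_apply x.1

/-- The σ-algebra `σ(ω_x : x ∈ Λ)`. -/
abbrev sigmaEnv {d : ℕ} (Λ : Set (Site d)) : MeasurableSpace (Env d) :=
  MeasurableSpace.comap (restrictEnv Λ) inferInstance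

/-- The spatial shift of an environment. -/
def shiftEnv {d : ℕ} (z : Site d) (ω : Env d) : Env d := fun x => ω (x + z)

/-- The `ℓ¹`-distance on `ℤ^d`. -/
def l1Dist {d : ℕ} (x y : Site d) : ℤ := ∑ i, |x i - y i|

/-- The `r`-boundary `{x ∉ V : d(x, V) ≤ r}` of `V`. -/
def boundary {d : ℕ} (r : ℕ) (V : Set (Site d)) : Set (Site d) :=
  {x | x ∉ V ∧ ∃ y ∈ V, l1Dist x y ≤ r}

/-- The environment law is invariant under the shifts of `ℤ^d`. -/
def IsStationary {d : ℕ} (P : Measure (Env d)) : Prop :=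
  ∀ z : Site d, P.map (shiftEnv z) = P

/-- Uniform ellipticity. -/
def IsUniformlyElliptic {d : ℕ} (P : Measure (Env d)) : Prop :=
  ∃ κ : ℝ, 0 < κ ∧ κ < 1 / (2 * (d : ℝ)) ∧ ∀ᵐ ω ∂P, ∀ e : Dir d, κ < (ω 0).1 e

/-- The `r`-Markov property: for finite `V`, conditioning `(ω_x)_{x ∈ V}` on the environment
outside `V` is the same as conditioning it on the environment on the `r`-boundary of `V`. -/
def IsRMarkov {d : ℕ} (r : ℕ) (P : Measure (Env d)) : Prop :=
  ∀ V : Set (Site d), V.Finite → ∀ B : Set (V → TransProb d), MeasurableSet B →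
    condExp (sigmaEnv Vᶜ) P ((restrictEnv V ⁻¹' B).indicator (fun _ => (1 : ℝ)))
      =ᵐ[P]
    condExp (sigmaEnv (boundary r V)) P ((restrictEnv V ⁻¹' B).indicator (fun _ => (1 : ℝ)))

/-- The regular conditional law `P((ω_x)_{x ∈ Δ} ∈ · | (ω_x)_{x ∈ Λ} = η)`. -/
noncomputable def condLaw {d : ℕ} [NeZero d] (P : Measure (Env d)) [IsFiniteMeasure P]
    (Δ Λ : Set (Site d)) (η : Λ → TransProb d) : Measure (Δ → TransProb d) :=
  condDistrib (restrictEnv Δ) (restrictEnv Λ) P η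

/-- The mixing condition: for finite `Δ ⊆ V` with `d(Δ, Vᶜ) ≥ r` and `A ⊆ Vᶜ`, the density of the
conditional law on `Δ` given `η` on `Vᶜ` with respect to the one given `η'` is at most
`exp (C ∑_{x ∈ A, y ∈ Δ} exp (-γ d(x, y)))`, for `P`-almost all pairs `η, η'` (that is, all pairs
from a set `G` of configurations of full measure) which agree on `Vᶜ \ A`. -/
def MixingCondition {d : ℕ} [NeZero d] (r : ℕ) (P : Measure (Env d)) [IsFiniteMeasure P] : Prop :=
  ∃ γ : ℝ, 0 < γ ∧ ∃ C : ℝ, 0 < C ∧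
    ∀ (Δ : Finset (Site d)) (V : Set (Site d)), V.Finite → (Δ : Set (Site d)) ⊆ V →
    (∀ x ∈ Δ, ∀ y ∉ V, (r : ℤ) ≤ l1Dist x y) →
    ∀ A : Set (Site d), A ⊆ Vᶜ →
    ∃ G : Set ((Vᶜ : Set (Site d)) → TransProb d),
      (∀ᵐ ω ∂P, restrictEnv Vᶜ ω ∈ G) ∧
      ∀ η ∈ G, ∀ η' ∈ G, (∀ x : (Vᶜ : Set (Site d)), x.1 ∉ A → η x = η' x) →
        condLaw P Δ Vᶜ η ≪ condLaw P Δ Vᶜ η' ∧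
        ∀ᵐ w ∂(condLaw P Δ Vᶜ η'),
          (condLaw P Δ Vᶜ η).rnDeriv (condLaw P Δ Vᶜ η') w
            ≤ ENNReal.ofReal (Real.exp
                (C * ∑' x : A, ∑ y ∈ Δ, Real.exp (-γ * (l1Dist x.1 y : ℝ))))

/-- The law of one step of the walk in the environment `ω`, started at `x`. -/
noncomputable def stepLaw {d : ℕ} (ω : Env d) (x : Site d) : Measure (Site d) :=
  ∑ e : Dir d, ENNReal.ofReal ((ω x).1 e) • Measure.dirac (x + e.1)

instance instProbStepLaw {d : ℕ} (ω : Env d) (x : Site d) :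
    IsProbabilityMeasure (stepLaw ω x) := by
  constructor
  simp only [stepLaw, Measure.coe_finsetSum, Finset.sum_apply, Measure.smul_apply,
    measure_univ, smul_eq_mul, mul_one]
  rw [← ENNReal.ofReal_sum_of_nonneg (fun e _ => (ω x).2.1 e), (ω x).2.2, ENNReal.ofReal_one]

/-- The transition of the walk in `ω` at time `n`, as a kernel from the past to the next site. -/
noncomputable def stepKernel {d : ℕ} (ω : Env d) (n : ℕ) :
    Kernel ((_ : Finset.Iic n) → Site d) (Site d) where
  toFun h := stepLaw ω (h ⟨n, Finset.mem_Iic.2 le_rfl⟩)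
  measurable' := measurable_of_countable _

instance instMarkovStepKernel {d : ℕ} (ω : Env d) (n : ℕ) : IsMarkovKernel (stepKernel ω n) :=
  ⟨fun h => instProbStepLaw ω (h ⟨n, Finset.mem_Iic.2 le_rfl⟩)⟩

/-- The quenched law `P_ω^x` of the walk in the environment `ω` started at `x`, on path space. -/
noncomputable def quenchedLaw {d : ℕ} (ω : Env d) (x : Site d) : Measure (ℕ → Site d) :=
  Kernel.traj (X := fun _ => Site d) (stepKernel ω) 0 (fun _ => x)

instance instProbQuenchedLaw {d : ℕ} (ω : Env d) (x : Site d) :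
    IsProbabilityMeasure (quenchedLaw ω x) := by
  unfold quenchedLaw; infer_instance

lemma measurable_stepLaw {d : ℕ} (x : Site d) (s : Set (Site d)) :
    Measurable (fun ω : Env d => stepLaw ω x s) := by
  simp only [stepLaw, Measure.coe_finsetSum, Finset.sum_apply, Measure.smul_apply, smul_eq_mul]
  refine Finset.measurable_sum _ fun e _ => Measurable.mul_const ?_ _
  exact ENNReal.measurable_ofReal.comp
    ((measurable_pi_apply e).comp (measurable_subtype_coe.comp (measurable_pi_apply x)))

lemma measurable_partialTraj {d : ℕ} (x : Site d) (n : ℕ)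
    (s : Set ((_ : Finset.Iic n) → Site d)) :
    Measurable (fun ω : Env d =>
      Kernel.partialTraj (X := fun _ => Site d) (stepKernel ω) 0 n (fun _ => x) s) := by
  induction n with
  | zero =>
    simp only [Kernel.partialTraj_self]
    exact measurable_const
  | succ n ih =>
    have hs : MeasurableSet s := Set.to_countable s |>.measurableSet
    simp_rw [Kernel.partialTraj_succ_eq_comp (Nat.zero_le n), Kernel.comp_apply' _ _ _ hs,
      lintegral_countable']
    refine Measurable.tsum fun b => Measurable.mul ?_ (ih {b})
    have hm : Measurable (IicProdIoc (X := fun _ => Site d) n (n + 1)) := measurable_IicProdIoc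
    have hs' : MeasurableSet (IicProdIoc (X := fun _ => Site d) n (n + 1) ⁻¹' s) := hm hs
    have hb : MeasurableSet
        (Prod.mk b ⁻¹' (IicProdIoc (X := fun _ => Site d) n (n + 1) ⁻¹' s)) :=
      measurable_prodMk_left hs'
    have key : ∀ ω : Env d,
        Kernel.partialTraj (X := fun _ => Site d) (stepKernel ω) n (n + 1) b s =
        stepLaw ω (b ⟨n, Finset.mem_Iic.2 le_rfl⟩)
          (MeasurableEquiv.piSingleton (X := fun _ => Site d) n ⁻¹'
            (Prod.mk b ⁻¹' (IicProdIoc (X := fun _ => Site d) n (n + 1) ⁻¹' s))) := by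
      intro ω
      rw [Kernel.partialTraj_succ_self, Kernel.map_apply' _ hm _ hs, Kernel.prod_apply' _ _ _ hs',
        Kernel.id_apply, lintegral_dirac' _ (measurable_of_countable _), Kernel.map_apply' _
          (MeasurableEquiv.piSingleton (X := fun _ => Site d) n).measurable _ hb]
      rfl
    simp_rw [key]
    exact measurable_stepLaw _ _

lemma measurable_quenchedLaw {d : ℕ} (x : Site d) :
    Measurable (fun ω : Env d => quenchedLaw ω x) := by
  refine Measurable.measure_of_isPiSystem_of_isProbabilityMeasure
    generateFrom_measurableCylinders.symm isPiSystem_measurableCylinders ?_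
  intro t ht
  rw [measurableCylinders_nat] at ht
  simp only [Set.mem_iUnion, Set.mem_singleton_iff] at ht
  obtain ⟨n, S, hS, rfl⟩ := ht
  have key : ∀ ω : Env d, quenchedLaw ω x (cylinder (Finset.Iic n) S) =
      Kernel.partialTraj (X := fun _ => Site d) (stepKernel ω) 0 n (fun _ => x) S := by
    intro ω
    rw [← Kernel.traj_map_frestrictLe_apply,
      Measure.map_apply (Preorder.measurable_frestrictLe n) hS]
    rfl
  simp_rw [key]
  exact measurable_partialTraj x n S

/-- `ω ↦ P_ω^x` as a Markov kernel. -/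
noncomputable def quenchedKernel {d : ℕ} (x : Site d) : Kernel (Env d) (ℕ → Site d) where
  toFun ω := quenchedLaw ω x
  measurable' := measurable_quenchedLaw x

instance instMarkovQuenchedKernel {d : ℕ} (x : Site d) :
    IsMarkovKernel (quenchedKernel (d := d) x) :=
  ⟨fun ω => instProbQuenchedLaw ω x⟩

/-- The joint law `P ⊗ P_ω^x` of the environment and the walk started at `x`. -/
noncomputable def annealedLaw {d : ℕ} (P : Measure (Env d)) (x : Site d) :
    Measure (Env d × (ℕ → Site d)) :=
  P ⊗ₘ quenchedKernel x

/-- The level `{y : y·e₁ = X₀·e₁ + j}` relative to the starting point of the path `X`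
(the coordinate of index `0` is the scalar product with `e₁`). -/
def level {d : ℕ} [NeZero d] (X : ℕ → Site d) (j : ℕ) : Set (Site d) :=
  {y | y 0 = X 0 0 + j}

/-- `D = inf {n ≥ 1 : X_n·e₁ ≤ X₀·e₁}`, with `inf ∅ = ∞`. -/
noncomputable def timeD {d : ℕ} [NeZero d] (X : ℕ → Site d) : ℕ∞ :=
  ⨅ (n : ℕ) (_ : 1 ≤ n ∧ X n 0 ≤ X 0 0), (n : ℕ∞)

/-- `R = inf {n ≥ 0 : ∑_{i=0}^n 1{X_i ∈ H_j} > c (j+1)² for some j ≥ 0} ∧ D`, with `inf ∅ = ∞`. -/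
noncomputable def timeR {d : ℕ} [NeZero d] (c : ℝ) (X : ℕ → Site d) : ℕ∞ :=
  (⨅ (n : ℕ) (_ : ∃ j : ℕ, c * ((j : ℝ) + 1) ^ 2 <
      ∑ i ∈ Finset.range (n + 1), (level X j).indicator (fun _ => (1 : ℝ)) (X i)), (n : ℕ∞))
    ⊓ timeD X

end RWRE

/-! Argue by contradiction: suppose that for every integer `c ≥ 1` the time `R(c)` is a.s. finite.
Call a path tame up to time `L` if neither condition defining `R(c)` has failed by then
(`tameUpTo`). The annealed probability of being tame then tends to `0` as `L → ∞`, and this forces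
the upper speed to be at most `0`.

Decoupling (`MixingCondition.exists_decoupling`). A tame path starting at level `m + r` visits
height `j` above its start at most `c (j+1)²` times, so the exponent in the mixing condition, summed
over its sites and over everything far enough below, is bounded uniformly in the length of the path.
Hence, given the walk up to its first visit to level `m`, starting a tame piece at level `m + r`
within a time window `K` is at most a constant, depending on `K` but not on `L`, times the
unconditional probability of being tame (`exists_pathLaw_inter_tameSoonAfter_le`).

Counting (`le_two_mul_card_tameSoonAfter`). If a walk climbs `M` levels within time `A M`, then with
`c = 8A` at least half of these levels are followed by a tame piece at one of `c + 1` scales. Apart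
from few levels, visits above are sparse and the next levels are reached quickly. If no scale gives
a tame piece, the level `m + r` is revisited in each of `c + 1` disjoint time windows, too often for
sparsity.

The scales are chosen successively so that tame pieces are rare given the past (`exists_scales`). By
Markov's inequality a block of `M` levels is crossed within time `A M` with conditional probability
at most `1/16` (`exists_block`). A union bound and Borel–Cantelli show that eventually fewer than
half of the blocks are crossed quickly, so the speed is of order at most `1/A`, for every `A`
(`ae_limsup_le_zero`). -/

namespace RWRE

/-! ### Cylinders and the quenched walk. -/

/-- The paths which agree with `p` up to time `n`. -/
def cyl {d : ℕ} (n : ℕ) (p : ℕ → Site d) : Set (ℕ → Site d) := {X | ∀ i ≤ n, X i = p i}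

lemma cyl_eq_preimage {d : ℕ} (n : ℕ) (p : ℕ → Site d) :
    cyl n p = Preorder.frestrictLe (π := fun _ => Site d) n ⁻¹'
      {Preorder.frestrictLe (π := fun _ => Site d) n p} := by
  ext X
  simp only [cyl, Set.mem_ofPred_eq, Set.mem_preimage, Set.mem_singleton_iff, funext_iff]
  exact ⟨fun h i => h i.1 (Finset.mem_Iic.1 i.2), fun h i hi => h ⟨i, Finset.mem_Iic.2 hi⟩⟩

lemma measurableSet_cyl {d : ℕ} (n : ℕ) (p : ℕ → Site d) : MeasurableSet (cyl n p) := by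
  rw [cyl_eq_preimage]
  exact (Preorder.measurable_frestrictLe n) (Set.to_countable _).measurableSet

lemma eq_preimage_of_cyl_subset {d : ℕ} {n : ℕ} {S : Set (ℕ → Site d)}
    (hS : ∀ X ∈ S, cyl n X ⊆ S) :
    S = Preorder.frestrictLe (π := fun _ => Site d) n ⁻¹'
      (Preorder.frestrictLe (π := fun _ => Site d) n '' S) := by
  refine subset_antisymm (Set.subset_preimage_image _ _) ?_
  rintro Y ⟨X, hX, hXY⟩
  refine hS X hX ?_
  rw [cyl_eq_preimage]
  exact hXY.symm

lemma measurableSet_of_cyl_subset {d : ℕ} {n : ℕ} {S : Set (ℕ → Site d)}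
    (hS : ∀ X ∈ S, cyl n X ⊆ S) : MeasurableSet S := by
  rw [eq_preimage_of_cyl_subset hS]
  exact (Preorder.measurable_frestrictLe n) (Set.to_countable _).measurableSet

/-- Two measures can be compared on a set that is determined by the first `n` steps by comparing
them on the cylinders. -/
lemma measure_le_of_cyl {d : ℕ} (μ ν : Measure (ℕ → Site d)) {n : ℕ} {S : Set (ℕ → Site d)}
    (hS : ∀ X ∈ S, cyl n X ⊆ S) (h : ∀ X ∈ S, μ (cyl n X) ≤ ν (cyl n X)) : μ S ≤ ν S := by
  rw [eq_preimage_of_cyl_subset hS]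
  have hm : ∀ y ∈ Preorder.frestrictLe (π := fun _ => Site d) n '' S,
      MeasurableSet (Preorder.frestrictLe (π := fun _ => Site d) n ⁻¹' {y}) := fun y _ =>
    (Preorder.measurable_frestrictLe n) (Set.to_countable _).measurableSet
  rw [← tsum_measure_preimage_singleton (Set.to_countable _) hm,
    ← tsum_measure_preimage_singleton (Set.to_countable _) hm]
  refine ENNReal.tsum_le_tsum ?_
  rintro ⟨_, X, hX, rfl⟩
  simpa only [cyl_eq_preimage] using h X hX

/-- The probability, in the environment `ω`, of the first `n` steps of `p`. -/
noncomputable def weight {d : ℕ} (ω : Env d) (n : ℕ) (p : ℕ → Site d) : ℝ≥0∞ :=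
  ∏ i ∈ Finset.range n, stepLaw ω (p i) {p (i + 1)}

lemma measurable_weight {d : ℕ} (n : ℕ) (p : ℕ → Site d) :
    Measurable (fun ω : Env d => weight ω n p) :=
  Finset.measurable_fun_prod _ fun _ _ => measurable_stepLaw _ _

/-- Comparisons of path measures below reduce to cylinders and hence to this product. It involves
the environment only at `p 0, …, p (n - 1)`, not at the endpoint `p n`. -/
lemma quenchedLaw_cyl {d : ℕ} (ω : Env d) (x : Site d) (n : ℕ) (p : ℕ → Site d) :
    quenchedLaw ω x (cyl n p) = if p 0 = x then weight ω n p else 0 := by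
  have key : quenchedLaw ω x (cyl n p) =
      Kernel.partialTraj (X := fun _ => Site d) (stepKernel ω) 0 n (fun _ => x)
        {Preorder.frestrictLe (π := fun _ => Site d) n p} := by
    rw [cyl_eq_preimage, ← Kernel.traj_map_frestrictLe_apply,
      Measure.map_apply (Preorder.measurable_frestrictLe n) (Set.to_countable _).measurableSet]
    rfl
  rw [key]
  clear key
  induction n with
  | zero =>
    rw [Kernel.partialTraj_self, Kernel.id_apply, Measure.dirac_apply' _
      (Set.to_countable _).measurableSet]
    by_cases h : p 0 = x
    · rw [if_pos h, Set.indicator_of_mem]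
      · simp [weight]
      · simp only [Set.mem_singleton_iff]
        funext i
        obtain ⟨i, hi⟩ := i
        have : i = 0 := by simpa using hi
        subst this
        exact h.symm
    · rw [if_neg h, Set.indicator_of_notMem]
      intro h'
      simp only [Set.mem_singleton_iff] at h'
      exact h (congrFun h' ⟨0, by simp⟩).symm
  | succ n ih =>
    set s : Set ((_ : Finset.Iic (n + 1)) → Site d) :=
      {Preorder.frestrictLe (π := fun _ => Site d) (n + 1) p} with hsdef
    have hs : MeasurableSet s := Set.to_countable s |>.measurableSet
    rw [Kernel.partialTraj_succ_eq_comp (Nat.zero_le n), Kernel.comp_apply' _ _ _ hs,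
      lintegral_countable']
    have hm : Measurable (IicProdIoc (X := fun _ => Site d) n (n + 1)) := measurable_IicProdIoc
    have hs' : MeasurableSet (IicProdIoc (X := fun _ => Site d) n (n + 1) ⁻¹' s) := hm hs
    have hb : ∀ b, MeasurableSet
        (Prod.mk b ⁻¹' (IicProdIoc (X := fun _ => Site d) n (n + 1) ⁻¹' s)) := fun b =>
      measurable_prodMk_left hs'
    have key : ∀ b,
        Kernel.partialTraj (X := fun _ => Site d) (stepKernel ω) n (n + 1) b s =
        stepLaw ω (b ⟨n, Finset.mem_Iic.2 le_rfl⟩)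
          (MeasurableEquiv.piSingleton (X := fun _ => Site d) n ⁻¹'
            (Prod.mk b ⁻¹' (IicProdIoc (X := fun _ => Site d) n (n + 1) ⁻¹' s))) := by
      intro b
      rw [Kernel.partialTraj_succ_self, Kernel.map_apply' _ hm _ hs, Kernel.prod_apply' _ _ _ hs',
        Kernel.id_apply, lintegral_dirac' _ (measurable_of_countable _), Kernel.map_apply' _
          (MeasurableEquiv.piSingleton (X := fun _ => Site d) n).measurable _ (hb b)]
      rfl
    have hset : ∀ (b : (_ : Finset.Iic n) → Site d) (z : Site d),
        z ∈ MeasurableEquiv.piSingleton (X := fun _ => Site d) n ⁻¹'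
          (Prod.mk b ⁻¹' (IicProdIoc (X := fun _ => Site d) n (n + 1) ⁻¹' s)) ↔
        b = Preorder.frestrictLe (π := fun _ => Site d) n p ∧ z = p (n + 1) := by
      intro b z
      simp only [Set.mem_preimage, hsdef, Set.mem_singleton_iff]
      constructor
      · intro h
        refine ⟨?_, ?_⟩
        · funext i
          have := congrFun h ⟨i.1, Finset.mem_Iic.2 ((Finset.mem_Iic.1 i.2).trans n.le_succ)⟩
          simpa [IicProdIoc, Finset.mem_Iic.1 i.2] using this
        · have := congrFun h ⟨n + 1, by simp⟩
          simpa [IicProdIoc, MeasurableEquiv.piSingleton] using this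
      · rintro ⟨rfl, rfl⟩
        funext i
        obtain ⟨i, hi⟩ := i
        rcases Nat.lt_or_ge n i with h | h
        · have : i = n + 1 := le_antisymm (Finset.mem_Iic.1 hi) h
          subst this
          simp [IicProdIoc, MeasurableEquiv.piSingleton]
        · simp [IicProdIoc, h]
    simp_rw [key]
    rw [tsum_eq_single (Preorder.frestrictLe (π := fun _ => Site d) n p)]
    · rw [ih]
      have : MeasurableEquiv.piSingleton (X := fun _ => Site d) n ⁻¹'
          (Prod.mk (Preorder.frestrictLe (π := fun _ => Site d) n p) ⁻¹'
            (IicProdIoc (X := fun _ => Site d) n (n + 1) ⁻¹' s)) = {p (n + 1)} := by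
        ext z
        rw [hset]
        simp
      rw [this]
      by_cases h : p 0 = x
      · rw [if_pos h, if_pos h, weight, weight, Finset.prod_range_succ, mul_comm]
        rfl
      · rw [if_neg h, if_neg h, mul_zero]
    · intro b hbne
      have : MeasurableEquiv.piSingleton (X := fun _ => Site d) n ⁻¹'
          (Prod.mk b ⁻¹' (IicProdIoc (X := fun _ => Site d) n (n + 1) ⁻¹' s)) = ∅ := by
        ext z
        rw [hset]
        simp [hbne]
      rw [this, measure_empty, zero_mul]

/-- Markov property of the quenched walk, for events determined by finitely many steps. -/
lemma quenchedLaw_cyl_inter_shift_le {d : ℕ} (ω : Env d) (x : Site d) (n L : ℕ)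
    (p : ℕ → Site d) {S : Set (ℕ → Site d)} (hS : ∀ X ∈ S, cyl L X ⊆ S) :
    quenchedLaw ω x (cyl n p ∩ {X | (fun s => X (n + s)) ∈ S}) ≤
      quenchedLaw ω (p n) S * quenchedLaw ω x (cyl n p) := by
  have hθ : Measurable (fun (X : ℕ → Site d) (s : ℕ) => X (n + s)) :=
    measurable_pi_lambda _ fun s => measurable_pi_apply _
  have hSm := measurableSet_of_cyl_subset hS
  have := measure_le_of_cyl
    (((quenchedLaw ω x).restrict (cyl n p)).map (fun X s => X (n + s)))
    ((quenchedLaw ω x (cyl n p)) • quenchedLaw ω (p n)) hS ?_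
  · rw [Measure.map_apply hθ hSm, Measure.restrict_apply (hθ hSm), Measure.smul_apply,
      smul_eq_mul, mul_comm, Set.inter_comm] at this
    exact this
  · intro τ _
    rw [Measure.map_apply hθ (measurableSet_cyl _ _),
      Measure.restrict_apply (hθ (measurableSet_cyl _ _)), Measure.smul_apply, smul_eq_mul]
    by_cases h0 : τ 0 = p n
    -- `σ` is the concatenation of `p` and `τ`; its weight factors at time `n`.
    · set σ : ℕ → Site d := fun i => if i ≤ n then p i else τ (i - n) with hσ
      have h1 : ∀ i ≤ n, σ i = p i := fun i hi => by simp [hσ, hi]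
      have h2 : ∀ i, σ (n + i) = τ i := by
        intro i
        rcases Nat.eq_zero_or_pos i with rfl | hi
        · simp [hσ, h0]
        · simp [hσ, hi.ne']
      have hsub : (fun (X : ℕ → Site d) (s : ℕ) => X (n + s)) ⁻¹' cyl L τ ∩ cyl n p ⊆
          cyl (n + L) σ := by
        rintro X ⟨hX1, hX2⟩ i hi
        rcases le_total i n with h | h
        · rw [h1 i h, hX2 i h]
        · obtain ⟨k, rfl⟩ := Nat.exists_eq_add_of_le h
          rw [h2]
          exact hX1 k (by omega)
      refine (measure_mono hsub).trans ?_
      rw [quenchedLaw_cyl, quenchedLaw_cyl, quenchedLaw_cyl, if_pos h0, h1 0 (Nat.zero_le _)]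
      split_ifs
      · simp only [weight, Finset.prod_range_add]
        refine le_of_eq ?_
        congr 1
        · refine Finset.prod_congr rfl fun i hi => ?_
          rw [Finset.mem_range] at hi
          rw [h1 i hi.le, h1 (i + 1) hi]
        · refine Finset.prod_congr rfl fun i _ => ?_
          rw [h2, add_assoc, h2]
      · simp
    · have : (fun (X : ℕ → Site d) (s : ℕ) => X (n + s)) ⁻¹' cyl L τ ∩ cyl n p = ∅ := by
        ext X
        simp only [Set.mem_inter_iff, Set.mem_preimage, Set.mem_empty_iff_false, iff_false, not_and]
        intro h3 h4
        exact h0 ((h3 0 (Nat.zero_le _)).symm.trans (h4 n le_rfl))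
      rw [this, measure_empty]
      exact zero_le

lemma stepLaw_ne_zero {d : ℕ} {ω : Env d} {x y : Site d} (h : stepLaw ω x {y} ≠ 0) :
    ∑ i, |y i - x i| ≤ 1 := by
  by_contra hlt
  apply h
  simp only [stepLaw, Measure.coe_finsetSum, Finset.sum_apply, Measure.smul_apply, smul_eq_mul]
  refine Finset.sum_eq_zero fun e _ => ?_
  rw [Measure.dirac_apply' _ (Set.to_countable _).measurableSet, Set.indicator_of_notMem, mul_zero]
  rintro h
  simp only [Set.mem_singleton_iff] at h
  subst h
  apply hlt
  calc ∑ i, |(x + e.1) i - x i| ≤ ∑ i, (e.1 i) ^ 2 := by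
        refine Finset.sum_le_sum fun i _ => ?_
        simp only [Pi.add_apply, add_sub_cancel_left]
        rw [← sq_abs]
        rcases eq_or_ne (e.1 i) 0 with h0 | h0
        · simp [h0]
        · have := Int.one_le_abs h0
          nlinarith
    _ = 1 := e.2
    _ ≤ 1 := le_rfl

lemma ae_steps_quenchedLaw {d : ℕ} (ω : Env d) (x : Site d) :
    ∀ᵐ X ∂(quenchedLaw ω x), ∀ n i, |X (n + 1) i - X n i| ≤ 1 := by
  rw [ae_all_iff]
  intro n
  have : quenchedLaw ω x {X | ¬ ∑ i, |X (n + 1) i - X n i| ≤ 1} ≤ (0 : Measure _)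
      {X : ℕ → Site d | ¬ ∑ i, |X (n + 1) i - X n i| ≤ 1} := by
    refine measure_le_of_cyl (n := n + 1) _ _ ?_ ?_
    · intro X hX Y hY
      simp only [Set.mem_ofPred_eq] at hX ⊢
      rwa [hY _ le_rfl, hY _ n.le_succ]
    · intro X hX
      rw [quenchedLaw_cyl]
      have : weight ω (n + 1) X = 0 := by
        by_contra h
        rw [← ne_eq, weight, Finset.prod_ne_zero_iff] at h
        exact hX (stepLaw_ne_zero (h n (by simp)))
      rw [this]
      simp
  have h0 : ∀ᵐ X ∂(quenchedLaw ω x), ∑ i, |X (n + 1) i - X n i| ≤ 1 := by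
    simpa [ae_iff] using this
  filter_upwards [h0] with X hX i
  exact (Finset.single_le_sum (f := fun i => |X (n + 1) i - X n i|) (fun _ _ => abs_nonneg _)
    (Finset.mem_univ i)).trans hX

lemma ae_start_quenchedLaw {d : ℕ} (ω : Env d) (x : Site d) :
    ∀ᵐ X ∂(quenchedLaw ω x), X 0 = x := by
  have : quenchedLaw ω x {X | ¬ X 0 = x} ≤ (0 : Measure _) {X : ℕ → Site d | ¬ X 0 = x} := by
    refine measure_le_of_cyl (n := 0) _ _ ?_ ?_
    · intro X hX Y hY
      simp only [Set.mem_ofPred_eq] at hX ⊢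
      rwa [hY _ le_rfl]
    · intro X hX
      rw [quenchedLaw_cyl, if_neg hX]
      simp
  simpa [ae_iff] using this

/-! ### Decoupling under comparable conditional laws. -/

lemma lintegral_le_mul_of_rnDeriv_le {α : Type*} [MeasurableSpace α] (μ ν : Measure α)
    [IsFiniteMeasure μ] [IsFiniteMeasure ν] (hac : μ ≪ ν) {B : ℝ≥0∞}
    (hB : ∀ᵐ w ∂ν, μ.rnDeriv ν w ≤ B) {g : α → ℝ≥0∞} (hg : Measurable g) :
    ∫⁻ w, g w ∂μ ≤ B * ∫⁻ w, g w ∂ν := by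
  rw [← Measure.withDensity_rnDeriv_eq μ ν hac,
    lintegral_withDensity_eq_lintegral_mul _ (Measure.measurable_rnDeriv μ ν) hg,
    ← lintegral_const_mul _ hg]
  refine lintegral_mono_ae ?_
  filter_upwards [hB] with w hw
  exact mul_le_mul_left hw _

/-- If the conditional laws of `Y` given `X` are mutually comparable up to the factor `B`, then the
expectation of a product decouples up to the factor `B`. -/
lemma lintegral_mul_le_of_condDistrib_comparable {Ω α β : Type*} [MeasurableSpace Ω]
    [MeasurableSpace α] [MeasurableSpace β] [StandardBorelSpace β] [Nonempty β]
    (P : Measure Ω) [IsProbabilityMeasure P] {X : Ω → α} {Y : Ω → β} (hX : Measurable X)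
    (hY : Measurable Y) {B : ℝ≥0∞} {G : Set α} (hG : ∀ᵐ ω ∂P, X ω ∈ G)
    (hcomp : ∀ η ∈ G, ∀ η' ∈ G, condDistrib Y X P η ≪ condDistrib Y X P η' ∧
      ∀ᵐ w ∂(condDistrib Y X P η'),
        (condDistrib Y X P η).rnDeriv (condDistrib Y X P η') w ≤ B)
    {h : α → ℝ≥0∞} {g : β → ℝ≥0∞} (hh : Measurable h) (hg : Measurable g) :
    ∫⁻ ω, h (X ω) * g (Y ω) ∂P ≤ B * (∫⁻ ω, h (X ω) ∂P) * ∫⁻ ω, g (Y ω) ∂P := by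
  have hk : Measurable fun η => ∫⁻ w, g w ∂(condDistrib Y X P η) := hg.lintegral_kernel
  have hprod : ∀ f : α → ℝ≥0∞, Measurable f → ∫⁻ ω, f (X ω) * g (Y ω) ∂P =
      ∫⁻ ω, f (X ω) * ∫⁻ w, g w ∂(condDistrib Y X P (X ω)) ∂P := by
    intro f hf
    have hF : Measurable fun p : α × β => f p.1 * g p.2 :=
      (hf.comp measurable_fst).mul (hg.comp measurable_snd)
    have h1 : ∫⁻ ω, f (X ω) * g (Y ω) ∂P =
        ∫⁻ p, f p.1 * g p.2 ∂(P.map fun ω => (X ω, Y ω)) :=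
      (lintegral_map hF (hX.prodMk hY)).symm
    rw [h1, ← compProd_map_condDistrib hY.aemeasurable, Measure.lintegral_compProd hF,
      lintegral_map _ hX]
    · simp_rw [lintegral_const_mul _ hg]
    · simp_rw [lintegral_const_mul _ hg]
      exact hf.mul hk
  have hone : ∫⁻ ω, g (Y ω) ∂P = ∫⁻ ω, ∫⁻ w, g w ∂(condDistrib Y X P (X ω)) ∂P := by
    simpa using hprod (fun _ => 1) measurable_const
  -- Averaging the comparison over the second configuration replaces its conditional law by the law
  -- of `Y`.
  have hae : ∀ᵐ ω ∂P, ∫⁻ w, g w ∂(condDistrib Y X P (X ω)) ≤ B * ∫⁻ ω, g (Y ω) ∂P := by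
    filter_upwards [hG] with ω hω
    rw [hone, ← lintegral_const_mul (f := fun ω => ∫⁻ w, g w ∂(condDistrib Y X P (X ω))) _
      (hk.comp hX)]
    calc ∫⁻ w, g w ∂(condDistrib Y X P (X ω))
        = ∫⁻ _, (∫⁻ w, g w ∂(condDistrib Y X P (X ω))) ∂P := by simp
      _ ≤ _ := by
        refine lintegral_mono_ae ?_
        filter_upwards [hG] with ω' hω'
        obtain ⟨hac, hB⟩ := hcomp _ hω _ hω'
        exact lintegral_le_mul_of_rnDeriv_le _ _ hac hB hg
  rw [hprod h hh]
  calc ∫⁻ ω, h (X ω) * ∫⁻ w, g w ∂(condDistrib Y X P (X ω)) ∂P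
      ≤ ∫⁻ ω, h (X ω) * (B * ∫⁻ ω, g (Y ω) ∂P) ∂P := by
        refine lintegral_mono_ae ?_
        filter_upwards [hae] with ω hω
        exact mul_le_mul_right hω _
    _ = _ := by
        rw [lintegral_mul_const (f := fun ω => h (X ω)) _ (hh.comp hX)]
        ring

/-! ### Exponential sums, tame paths and the use of mixing. -/

lemma summable_exp_neg_abs_int {β : ℝ} (hβ : 0 < β) :
    Summable fun k : ℤ => Real.exp (-β * |(k : ℝ)|) := by
  have h : Summable fun n : ℕ => Real.exp (-β * n) := by
    have := Real.summable_exp_nat_mul_iff.2 (neg_neg_of_pos hβ)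
    simpa [mul_comm] using this
  rw [summable_int_iff_summable_nat_and_neg]
  constructor <;> simpa using h

/-- For the `ℓ¹`-distance the exponential is a product over coordinates, so enlarging `F` to a box
gives a product of one-dimensional series, uniformly in `y`. -/
lemma exists_sum_exp_l1Dist_le (d : ℕ) {β : ℝ} (hβ : 0 < β) :
    ∃ S : ℝ, 0 ≤ S ∧ ∀ (y : Site d) (F : Finset (Site d)),
      ∑ x ∈ F, Real.exp (-β * (l1Dist x y : ℝ)) ≤ S := by
  classical
  refine ⟨(∑' k : ℤ, Real.exp (-β * |(k : ℝ)|)) ^ d,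
    pow_nonneg (tsum_nonneg fun _ => (Real.exp_pos _).le) _, fun y F => ?_⟩
  have hone : ∀ (a : ℤ) (G : Finset ℤ), ∑ k ∈ G, Real.exp (-β * |((k - a : ℤ) : ℝ)|) ≤
      ∑' k : ℤ, Real.exp (-β * |(k : ℝ)|) := by
    intro a G
    rw [← (Equiv.subRight a).tsum_eq]
    refine Summable.sum_le_tsum (f := fun k : ℤ => Real.exp (-β * |((k - a : ℤ) : ℝ)|)) G
      (fun _ _ => (Real.exp_pos _).le) ?_
    exact (Equiv.subRight a).summable_iff.2 (summable_exp_neg_abs_int hβ)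
  calc ∑ x ∈ F, Real.exp (-β * (l1Dist x y : ℝ))
      = ∑ x ∈ F, ∏ i, Real.exp (-β * |((x i - y i : ℤ) : ℝ)|) := by
        refine Finset.sum_congr rfl fun x _ => ?_
        rw [← Real.exp_sum, l1Dist, Int.cast_sum, Finset.mul_sum]
        simp only [Int.cast_abs]
    _ ≤ ∑ x ∈ Fintype.piFinset fun i => F.image fun x => x i,
          ∏ i, Real.exp (-β * |((x i - y i : ℤ) : ℝ)|) := by
        refine Finset.sum_le_sum_of_subset_of_nonneg ?_ fun _ _ _ =>
          Finset.prod_nonneg fun _ _ => (Real.exp_pos _).le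
        intro x hx
        rw [Fintype.mem_piFinset]
        exact fun i => Finset.mem_image_of_mem _ hx
    _ = ∏ i, ∑ k ∈ F.image fun x => x i, Real.exp (-β * |((k - y i : ℤ) : ℝ)|) := by
        rw [Finset.prod_univ_sum]
    _ ≤ ∏ _i : Fin d, ∑' k : ℤ, Real.exp (-β * |(k : ℝ)|) :=
        Finset.prod_le_prod (fun _ _ => Finset.sum_nonneg fun _ _ => (Real.exp_pos _).le)
          fun i _ => hone _ _
    _ = _ := by simp

lemma l1Dist_comm {d : ℕ} (x y : Site d) : l1Dist x y = l1Dist y x := by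
  simp only [l1Dist, abs_sub_comm]

lemma abs_sub_le_l1Dist {d : ℕ} (x y : Site d) (i : Fin d) : |x i - y i| ≤ l1Dist x y :=
  Finset.single_le_sum (f := fun i => |x i - y i|) (fun _ _ => abs_nonneg _) (Finset.mem_univ i)

lemma finite_l1Dist_le {d : ℕ} (y : Site d) (b : ℤ) : {x | l1Dist x y ≤ b}.Finite := by
  refine (Set.finite_Icc (fun i => y i - b) (fun i => y i + b)).subset fun x hx => ?_
  have h : ∀ i, |x i - y i| ≤ b := fun i => (abs_sub_le_l1Dist x y i).trans hx
  exact ⟨fun i => by have := abs_le.1 (h i); simp only; omega,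
    fun i => by have := abs_le.1 (h i); simp only; omega⟩

/-- Extension of an environment on `Λ` by a constant. -/
noncomputable def extendEnv {d : ℕ} [NeZero d] (Λ : Set (Site d)) (η : Λ → TransProb d) : Env d :=
  open Classical in fun x => if h : x ∈ Λ then η ⟨x, h⟩ else Classical.arbitrary _

lemma measurable_extendEnv {d : ℕ} [NeZero d] (Λ : Set (Site d)) :
    Measurable (extendEnv Λ) := by
  refine measurable_pi_lambda _ fun x => ?_
  by_cases h : x ∈ Λ
  · simpa only [extendEnv, h, dite_true] using measurable_pi_apply _
  · simpa only [extendEnv, h, dite_false] using measurable_const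

lemma stepLaw_congr {d : ℕ} {ω ω' : Env d} {x : Site d} (h : ω x = ω' x) :
    stepLaw ω x = stepLaw ω' x := by
  simp only [stepLaw, h]

/-- Presents the weight as a function of the restricted environment, the form needed for conditional
laws; the filling outside `Λ` is immaterial. -/
lemma weight_extendEnv {d : ℕ} [NeZero d] (Λ : Set (Site d)) (ω : Env d) {n : ℕ}
    {p : ℕ → Site d} (h : ∀ i < n, p i ∈ Λ) :
    weight (extendEnv Λ (restrictEnv Λ ω)) n p = weight ω n p := by
  refine Finset.prod_congr rfl fun i hi => ?_
  rw [stepLaw_congr]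
  simp [extendEnv, restrictEnv, h i (Finset.mem_range.1 hi)]

/-- The paths which, up to time `L`, neither return to the level of their starting point or below
nor, for any `j ≥ 0`, visit the level at height `j` above it more than `c (j+1)²` times before
time `L`. -/
def tameUpTo {d : ℕ} [NeZero d] (c L : ℕ) : Set (ℕ → Site d) :=
  {X | (∀ s, 1 ≤ s → s ≤ L → X 0 0 < X s 0) ∧
    ∀ j : ℕ, ((Finset.range L).filter fun i => X i 0 = X 0 0 + j).card ≤ c * (j + 1) ^ 2}

lemma cyl_subset_tameUpTo {d : ℕ} [NeZero d] (c L : ℕ) :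
    ∀ X ∈ tameUpTo (d := d) c L, cyl L X ⊆ tameUpTo c L := by
  intro X hX Y hY
  refine ⟨fun s h1 h2 => ?_, fun j => ?_⟩
  · rw [hY 0 (Nat.zero_le _), hY s h2]
    exact hX.1 s h1 h2
  · refine le_trans (le_of_eq ?_) (hX.2 j)
    congr 1
    refine Finset.filter_congr fun i hi => ?_
    rw [hY 0 (Nat.zero_le _), hY i (Finset.mem_range.1 hi).le]

lemma summable_sq_mul_exp {β : ℝ} (hβ : 0 < β) :
    Summable fun j : ℕ => ((j : ℝ) + 1) ^ 2 * Real.exp (-β * j) := by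
  have h := (summable_nat_add_iff 1).2 (Real.summable_pow_mul_exp_neg_nat_mul 2 hβ)
  refine (h.mul_left (Real.exp β)).congr fun j => ?_
  push_cast
  rw [show -β * ((j : ℝ) + 1) = -β * j + -β by ring, Real.exp_add, Real.exp_neg β]
  field_simp

/-- Group the times by height. The quadratic bound on visits is beaten by the exponential, so the
result does not depend on `L`. -/
lemma sum_exp_le_of_tameUpTo {d : ℕ} [NeZero d] {β : ℝ} (hβ : 0 < β) {c L : ℕ}
    {τ : ℕ → Site d} (hτ : τ ∈ tameUpTo c L) :
    ∑ i ∈ Finset.range L, Real.exp (-β * ((τ i 0 - τ 0 0 : ℤ) : ℝ)) ≤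
      c * ∑' j : ℕ, ((j : ℝ) + 1) ^ 2 * Real.exp (-β * j) := by
  classical
  have hnn : ∀ i < L, 0 ≤ τ i 0 - τ 0 0 := by
    intro i hi
    rcases Nat.eq_zero_or_pos i with rfl | h
    · simp
    · have := hτ.1 i h hi.le
      omega
  calc ∑ i ∈ Finset.range L, Real.exp (-β * ((τ i 0 - τ 0 0 : ℤ) : ℝ))
      = ∑ i ∈ Finset.range L, (fun j : ℕ => Real.exp (-β * j)) (τ i 0 - τ 0 0).toNat := by
        refine Finset.sum_congr rfl fun i hi => ?_
        have := Int.toNat_of_nonneg (hnn i (Finset.mem_range.1 hi))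
        simp only
        rw [← Int.cast_natCast, this]
    _ = ∑ j ∈ (Finset.range L).image fun i => (τ i 0 - τ 0 0).toNat,
          ((Finset.range L).filter fun i => (τ i 0 - τ 0 0).toNat = j).card •
            Real.exp (-β * j) := by
        rw [Finset.sum_comp (fun j : ℕ => Real.exp (-β * j))]
    _ ≤ ∑ j ∈ (Finset.range L).image fun i => (τ i 0 - τ 0 0).toNat,
          c * (((j : ℝ) + 1) ^ 2 * Real.exp (-β * j)) := by
        refine Finset.sum_le_sum fun j _ => ?_
        rw [nsmul_eq_mul, ← mul_assoc]
        refine mul_le_mul_of_nonneg_right ?_ (Real.exp_pos _).le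
        have h := hτ.2 j
        have h' : ((Finset.range L).filter fun i => (τ i 0 - τ 0 0).toNat = j).card ≤
            c * (j + 1) ^ 2 := by
          refine le_trans (Finset.card_le_card ?_) h
          intro i hi
          rw [Finset.mem_filter] at hi ⊢
          have := hnn i (Finset.mem_range.1 hi.1)
          exact ⟨hi.1, by omega⟩
        exact_mod_cast h'
    _ ≤ c * ∑' j : ℕ, ((j : ℝ) + 1) ^ 2 * Real.exp (-β * j) := by
        rw [← Finset.mul_sum]
        refine mul_le_mul_of_nonneg_left ?_ (Nat.cast_nonneg _)
        exact (summable_sq_mul_exp hβ).sum_le_tsum _ fun _ _ => by positivity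

/-- Under the mixing condition, the environment along a path which stays below the level `m`
decouples from the environment along a tame path started at the level `m + r`. -/
lemma MixingCondition.exists_decoupling {d : ℕ} [NeZero d] {r : ℕ} {P : Measure (Env d)}
    [IsProbabilityMeasure P] (hmix : MixingCondition r P) (c : ℕ) :
    ∃ B : ℝ≥0∞, B ≠ ∞ ∧ ∀ (m : ℤ) (N L : ℕ) (p τ : ℕ → Site d), (∀ i < N, p i 0 < m) →
      τ 0 0 = m + r → τ ∈ tameUpTo c L →
      ∫⁻ ω, weight ω N p * weight ω L τ ∂P ≤
        B * (∫⁻ ω, weight ω N p ∂P) * ∫⁻ ω, weight ω L τ ∂P := by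
  classical
  obtain ⟨γ, hγ, C, hC, hmix⟩ := hmix
  obtain ⟨S, hS0, hS⟩ := exists_sum_exp_l1Dist_le d (half_pos hγ)
  set Z : ℝ := ∑' j : ℕ, ((j : ℝ) + 1) ^ 2 * Real.exp (-(γ / 2) * j) with hZ
  have hZ0 : 0 ≤ Z := tsum_nonneg fun j => by positivity
  refine ⟨ENNReal.ofReal (Real.exp (C * (S * (c * Z)))), ENNReal.ofReal_ne_top, ?_⟩
  intro m N L p τ hp hτ0 hτ
  set Δ : Finset (Site d) := (Finset.range L).image τ with hΔ
  -- A finite substitute for the half-space above level `m`: each ball reaches down exactly to `m`,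
  -- so `V` misses the path `p`, while its radius is at least `r`.
  set V : Set (Site d) := ⋃ y ∈ Δ, {x | l1Dist x y ≤ y 0 - m} with hV
  have hlev : ∀ i < L, τ 0 0 ≤ τ i 0 := by
    intro i hi
    rcases Nat.eq_zero_or_pos i with rfl | h
    · exact le_rfl
    · exact (hτ.1 i h hi.le).le
  have hlevΔ : ∀ y ∈ Δ, m + r ≤ y 0 := by
    intro y hy
    obtain ⟨i, hi, rfl⟩ := Finset.mem_image.1 hy
    rw [← hτ0]
    exact hlev i (Finset.mem_range.1 hi)
  have hVfin : V.Finite := Set.Finite.biUnion Δ.finite_toSet fun y _ => finite_l1Dist_le y _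
  have hVc : ∀ x ∉ V, ∀ y ∈ Δ, y 0 - m < l1Dist x y := by
    intro x hx y hy
    by_contra hlt
    exact hx (Set.mem_biUnion (x := y) hy (not_lt.1 hlt))
  have hΔV : (Δ : Set (Site d)) ⊆ V := by
    intro y hy
    refine Set.mem_biUnion hy ?_
    have := hlevΔ y hy
    simp only [Set.mem_ofPred_eq, l1Dist, sub_self, abs_zero, Finset.sum_const_zero]
    omega
  have hdist : ∀ x ∈ Δ, ∀ y ∉ V, (r : ℤ) ≤ l1Dist x y := by
    intro x hx y hy
    rw [l1Dist_comm]
    have h1 := hVc y hy x hx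
    have h2 := hlevΔ x hx
    omega
  -- With `A = Vᶜ` the agreement condition is void, so all pairs in `G` are comparable.
  obtain ⟨G, hG, hcomp⟩ := hmix Δ V hVfin hΔV hdist Vᶜ le_rfl
  have hsum : ∑' x : (Vᶜ : Set (Site d)), ∑ y ∈ Δ, Real.exp (-γ * (l1Dist x.1 y : ℝ)) ≤
      S * (c * Z) := by
    refine Real.tsum_le_of_sum_le (fun x => Finset.sum_nonneg fun _ _ => (Real.exp_pos _).le) ?_
    intro F
    rw [Finset.sum_comm]
    calc ∑ y ∈ Δ, ∑ x ∈ F, Real.exp (-γ * (l1Dist x.1 y : ℝ))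
        -- Half of the decay rate is spent on summing over `x`; the other half, since `x` is at
        -- distance at least the height of `y`, on summing over the tame path.
        ≤ ∑ y ∈ Δ, S * Real.exp (-(γ / 2) * ((y 0 - τ 0 0 : ℤ) : ℝ)) := by
          refine Finset.sum_le_sum fun y hy => ?_
          calc ∑ x ∈ F, Real.exp (-γ * (l1Dist x.1 y : ℝ))
              ≤ ∑ x ∈ F, Real.exp (-(γ / 2) * (l1Dist x.1 y : ℝ)) *
                  Real.exp (-(γ / 2) * ((y 0 - τ 0 0 : ℤ) : ℝ)) := by
                refine Finset.sum_le_sum fun x _ => ?_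
                rw [← Real.exp_add]
                refine Real.exp_le_exp.2 ?_
                have h1 : y 0 - τ 0 0 ≤ l1Dist x.1 y := by
                  have := hVc x.1 x.2 y hy
                  omega
                have h2 : ((y 0 - τ 0 0 : ℤ) : ℝ) ≤ (l1Dist x.1 y : ℝ) := by exact_mod_cast h1
                nlinarith
            _ ≤ _ := by
                rw [← Finset.sum_mul]
                refine mul_le_mul_of_nonneg_right ?_ (Real.exp_pos _).le
                have := hS y (F.map (Function.Embedding.subtype _))
                rwa [Finset.sum_map] at this
      _ ≤ S * (c * Z) := by
          rw [← Finset.mul_sum]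
          refine mul_le_mul_of_nonneg_left ?_ hS0
          refine le_trans ?_ (sum_exp_le_of_tameUpTo (half_pos hγ) hτ)
          exact Finset.sum_image_le_of_nonneg (fun _ _ => (Real.exp_pos _).le)
  have hpV : ∀ i < N, p i ∈ Vᶜ := by
    intro i hi hmem
    simp only [hV, Set.mem_iUnion, Set.mem_ofPred_eq, exists_prop] at hmem
    obtain ⟨y, hy, hxy⟩ := hmem
    have h1 := (abs_sub_le_l1Dist (p i) y 0).trans hxy
    have h2 := hp i hi
    rw [abs_le] at h1
    omega
  have hτΔ : ∀ i < L, τ i ∈ (Δ : Set (Site d)) := fun i hi =>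
    Finset.mem_image_of_mem _ (Finset.mem_range.2 hi)
  have key := lintegral_mul_le_of_condDistrib_comparable P (measurable_restrictEnv Vᶜ)
    (measurable_restrictEnv (Δ : Set (Site d)))
    (B := ENNReal.ofReal (Real.exp (C * (S * (c * Z))))) hG
    (fun η hη η' hη' => by
      obtain ⟨h1, h2⟩ := hcomp η hη η' hη' fun x hx => absurd x.2 hx
      refine ⟨h1, ?_⟩
      filter_upwards [h2] with w hw
      refine hw.trans (ENNReal.ofReal_le_ofReal (Real.exp_le_exp.2 ?_))
      exact mul_le_mul_of_nonneg_left hsum hC.le)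
    (h := fun η => weight (extendEnv Vᶜ η) N p) (g := fun η => weight (extendEnv _ η) L τ)
    ((measurable_weight N p).comp (measurable_extendEnv _))
    ((measurable_weight L τ).comp (measurable_extendEnv _))
  simp_rw [weight_extendEnv Vᶜ _ hpV, weight_extendEnv _ _ hτΔ] at key
  exact key

/-! ### The annealed law of the path. -/

/-- The annealed law of the walk started at `x`. -/
noncomputable def pathLaw {d : ℕ} (P : Measure (Env d)) (x : Site d) : Measure (ℕ → Site d) :=
  P.bind (quenchedKernel x)

lemma pathLaw_apply {d : ℕ} (P : Measure (Env d)) (x : Site d) {S : Set (ℕ → Site d)}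
    (hS : MeasurableSet S) : pathLaw P x S = ∫⁻ ω, quenchedLaw ω x S ∂P :=
  Measure.bind_apply hS (quenchedKernel x).measurable.aemeasurable

instance instIsProbabilityMeasurePathLaw {d : ℕ} (P : Measure (Env d)) [IsProbabilityMeasure P]
    (x : Site d) : IsProbabilityMeasure (pathLaw P x) := by
  constructor
  rw [pathLaw_apply _ _ MeasurableSet.univ]
  simp

lemma annealedLaw_snd {d : ℕ} (P : Measure (Env d)) [IsProbabilityMeasure P] (x : Site d)
    {S : Set (ℕ → Site d)} (hS : MeasurableSet S) :
    annealedLaw P x {p | p.2 ∈ S} = pathLaw P x S := by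
  rw [pathLaw, ← Measure.snd_compProd, Measure.snd_apply hS]
  rfl

lemma ae_pathLaw {d : ℕ} (P : Measure (Env d)) (x : Site d) {S : Set (ℕ → Site d)}
    (hS : MeasurableSet S) (h : ∀ ω, ∀ᵐ X ∂(quenchedLaw ω x), X ∈ S) :
    ∀ᵐ X ∂(pathLaw P x), X ∈ S := by
  rw [ae_iff]
  change pathLaw P x Sᶜ = 0
  rw [pathLaw_apply _ _ hS.compl]
  have : ∀ ω, quenchedLaw ω x Sᶜ = 0 := fun ω => h ω
  simp [this]

lemma ae_steps_pathLaw {d : ℕ} (P : Measure (Env d)) (x : Site d) :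
    ∀ᵐ X ∂(pathLaw P x), ∀ n i, |X (n + 1) i - X n i| ≤ 1 := by
  refine ae_pathLaw P x (S := {X | ∀ n i, |X (n + 1) i - X n i| ≤ 1}) ?_
    fun ω => ae_steps_quenchedLaw ω x
  have : {X : ℕ → Site d | ∀ n i, |X (n + 1) i - X n i| ≤ 1} =
      ⋂ n, {X | ∀ i, |X (n + 1) i - X n i| ≤ 1} := by
    ext; simp
  rw [this]
  refine MeasurableSet.iInter fun n => measurableSet_of_cyl_subset (n := n + 1) ?_
  intro X hX Y hY
  simp only [Set.mem_ofPred_eq] at hX ⊢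
  rwa [hY _ le_rfl, hY _ n.le_succ]

lemma ae_start_pathLaw {d : ℕ} (P : Measure (Env d)) (x : Site d) :
    ∀ᵐ X ∂(pathLaw P x), X 0 = x := by
  refine ae_pathLaw P x (S := {X | X 0 = x}) ?_ fun ω => ae_start_quenchedLaw ω x
  refine measurableSet_of_cyl_subset (n := 0) fun X hX Y hY => ?_
  simp only [Set.mem_ofPred_eq] at hX ⊢
  rwa [hY _ le_rfl]

lemma stepLaw_shiftEnv {d : ℕ} (z : Site d) (ω : Env d) (x y : Site d) :
    stepLaw (shiftEnv z ω) x {y} = stepLaw ω (x + z) {y + z} := by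
  simp only [stepLaw, Measure.coe_finsetSum, Finset.sum_apply, Measure.smul_apply, shiftEnv]
  refine Finset.sum_congr rfl fun e _ => ?_
  rw [Measure.dirac_apply' _ (Set.to_countable _).measurableSet,
    Measure.dirac_apply' _ (Set.to_countable _).measurableSet]
  congr 1
  simp only [Set.indicator_apply, Set.mem_singleton_iff, Pi.one_apply]
  have : x + e.1 = y ↔ x + z + e.1 = y + z := by
    rw [add_right_comm]
    exact (add_left_inj z).symm
  simp only [this]

lemma measurable_shiftEnv {d : ℕ} (z : Site d) : Measurable (shiftEnv (d := d) z) :=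
  measurable_pi_lambda _ fun _ => measurable_pi_apply _

lemma IsStationary.lintegral_weight {d : ℕ} {P : Measure (Env d)} (hstat : IsStationary P)
    (z : Site d) (n : ℕ) (p : ℕ → Site d) :
    ∫⁻ ω, weight ω n (fun i => p i + z) ∂P = ∫⁻ ω, weight ω n p ∂P := by
  conv_rhs => rw [← hstat z, lintegral_map (measurable_weight n p) (measurable_shiftEnv z)]
  refine lintegral_congr fun ω => ?_
  simp only [weight, stepLaw_shiftEnv]

lemma mem_tameUpTo_add_iff {d : ℕ} [NeZero d] (c L : ℕ) (x : Site d) (X : ℕ → Site d) :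
    (fun i => X i + x) ∈ tameUpTo c L ↔ X ∈ tameUpTo c L := by
  simp only [tameUpTo, Set.mem_ofPred_eq, Pi.add_apply, add_lt_add_iff_right,
    add_right_comm _ (x 0), add_left_inj]

lemma measurable_quenchedLaw_apply {d : ℕ} (x : Site d) {S : Set (ℕ → Site d)}
    (hS : MeasurableSet S) : Measurable fun ω : Env d => quenchedLaw ω x S :=
  (Measure.measurable_coe hS).comp (measurable_quenchedLaw x)

/-- Given the first steps of the walk, all below level `m`, the annealed probability of being tame
after a visit to a given site of the level `m + r` is comparable to the unconditional one. -/
lemma exists_pathLaw_cyl_inter_tame_le {d : ℕ} [NeZero d] {r : ℕ} {P : Measure (Env d)}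
    [IsProbabilityMeasure P] (hstat : IsStationary P) (hmix : MixingCondition r P) (c : ℕ) :
    ∃ B : ℝ≥0∞, B ≠ ∞ ∧ ∀ (m : ℤ) (N L k : ℕ) (p : ℕ → Site d) (x : Site d),
      (∀ i < N, p i 0 < m) → x 0 = m + r →
      pathLaw P 0 (cyl N p ∩ {X | X (N + k) = x ∧ (fun s => X (N + k + s)) ∈ tameUpTo c L}) ≤
        B * pathLaw P 0 (tameUpTo c L) * pathLaw P 0 (cyl N p) := by
  obtain ⟨B, hB, hdec⟩ := hmix.exists_decoupling c
  refine ⟨B, hB, fun m N L k p x hp hx => ?_⟩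
  have hUm : MeasurableSet (tameUpTo (d := d) c L) :=
    measurableSet_of_cyl_subset (cyl_subset_tameUpTo c L)
  have hθ : Measurable (fun (X : ℕ → Site d) (s : ℕ) => X (N + k + s)) :=
    measurable_pi_lambda _ fun s => measurable_pi_apply _
  have hSsat : ∀ X ∈ cyl N p ∩ {X : ℕ → Site d | X (N + k) = x},
      cyl (N + k) X ⊆ cyl N p ∩ {X | X (N + k) = x} := by
    rintro X ⟨hX1, hX2⟩ Y hY
    refine ⟨fun i hi => ?_, ?_⟩
    · rw [hY i (by omega), hX1 i hi]
    · simp only [Set.mem_ofPred_eq] at hX2 ⊢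
      rwa [hY _ le_rfl]
  have hSm := measurableSet_of_cyl_subset hSsat
  have hset : cyl N p ∩ {X | X (N + k) = x ∧ (fun s => X (N + k + s)) ∈ tameUpTo c L} =
      (cyl N p ∩ {X | X (N + k) = x}) ∩ {X | (fun s => X (N + k + s)) ∈ tameUpTo c L} := by
    ext X
    simp only [Set.mem_inter_iff, Set.mem_ofPred_eq, and_assoc]
  -- Markov property at time `N + k`, after which the constraint `X (N + k) = x` is dropped. The
  -- sites visited between times `N` and `N + k` thus play no role, and only environments that
  -- mixing can separate remain.
  have hquenched : ∀ ω : Env d, quenchedLaw ω 0 ((cyl N p ∩ {X | X (N + k) = x}) ∩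
      {X | (fun s => X (N + k + s)) ∈ tameUpTo c L}) ≤
      quenchedLaw ω x (tameUpTo c L) * quenchedLaw ω 0 (cyl N p) := by
    intro ω
    have := measure_le_of_cyl
      ((quenchedLaw ω 0).restrict {X | (fun s => X (N + k + s)) ∈ tameUpTo c L})
      (quenchedLaw ω x (tameUpTo c L) • quenchedLaw ω 0) hSsat ?_
    · rw [Measure.restrict_apply hSm, Measure.smul_apply, smul_eq_mul] at this
      exact this.trans (mul_le_mul_right (measure_mono Set.inter_subset_left) _)
    · intro X hX
      rw [Measure.restrict_apply (measurableSet_cyl _ _), Measure.smul_apply, smul_eq_mul]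
      have := quenchedLaw_cyl_inter_shift_le ω 0 (N + k) L X (cyl_subset_tameUpTo c L)
      rwa [hX.2] at this
  have hUθ : MeasurableSet {X : ℕ → Site d | (fun s => X (N + k + s)) ∈ tameUpTo c L} := hθ hUm
  rw [hset, pathLaw_apply _ _ (hSm.inter hUθ), pathLaw_apply _ _ (measurableSet_cyl N p)]
  refine (lintegral_mono hquenched).trans ?_
  by_cases hp0 : p 0 = 0
  swap
  · simp [quenchedLaw_cyl, hp0]
  simp_rw [quenchedLaw_cyl, if_pos hp0]
  have htr : Measurable fun (X : ℕ → Site d) i => X i + x :=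
    measurable_pi_lambda _ fun i =>
      (measurable_of_countable fun y : Site d => y + x).comp (measurable_pi_apply i)
  have hbind : ∀ S : Set (ℕ → Site d), MeasurableSet S →
      (P.withDensity fun ω => weight ω N p).bind (quenchedKernel x) S =
        ∫⁻ ω, weight ω N p * quenchedLaw ω x S ∂P := fun S hS => by
    rw [Measure.bind_apply hS (quenchedKernel x).measurable.aemeasurable]
    exact lintegral_withDensity_eq_lintegral_mul _ (measurable_weight N p)
      (measurable_quenchedLaw_apply x hS)
  have hcomp := measure_le_of_cyl
    ((P.withDensity fun ω => weight ω N p).bind (quenchedKernel x))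
    ((B * ∫⁻ ω, weight ω N p ∂P) • (pathLaw P 0).map fun X i => X i + x)
    (cyl_subset_tameUpTo (d := d) c L) ?_
  · rw [hbind _ hUm, Measure.smul_apply, Measure.map_apply htr hUm] at hcomp
    have hpre : (fun (X : ℕ → Site d) i => X i + x) ⁻¹' tameUpTo c L = tameUpTo c L := by
      ext X
      exact mem_tameUpTo_add_iff c L x X
    rw [hpre, smul_eq_mul] at hcomp
    calc ∫⁻ ω, quenchedLaw ω x (tameUpTo c L) * weight ω N p ∂P
        = ∫⁻ ω, weight ω N p * quenchedLaw ω x (tameUpTo c L) ∂P :=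
          lintegral_congr fun ω => mul_comm _ _
      _ ≤ _ := hcomp
      _ = _ := by ring
  · intro τ hτ
    rw [hbind _ (measurableSet_cyl _ _), Measure.smul_apply,
      Measure.map_apply htr (measurableSet_cyl _ _), smul_eq_mul]
    have hpre : (fun (X : ℕ → Site d) i => X i + x) ⁻¹' cyl L τ = cyl L fun i => τ i - x := by
      ext X
      simp only [cyl, Set.mem_preimage, Set.mem_ofPred_eq, eq_sub_iff_add_eq]
    rw [hpre, pathLaw_apply _ _ (measurableSet_cyl _ _)]
    simp only [quenchedLaw_cyl, sub_eq_zero]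
    by_cases hτ0 : τ 0 = x
    · simp only [if_pos hτ0]
      -- Stationarity moves the start of the tame path from the origin to `x`.
      rw [← hstat.lintegral_weight x L fun i => τ i - x]
      simp only [sub_add_cancel]
      exact hdec m N L p τ hp (by rw [hτ0, hx]) hτ
    · simp [hτ0]

/-! ### Hitting times of levels and events stopped there. -/

/-- The first time at which the walk is at the level `m` or above. -/
noncomputable def hitTime {d : ℕ} [NeZero d] (m : ℤ) (X : ℕ → Site d) : ℕ :=
  sInf {n | m ≤ X n 0}

/-- For a level that is never reached `hitTime` is `sInf ∅ = 0`, so reaching the level has to be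
assumed here and recorded in the events below. -/
lemma hitTime_spec {d : ℕ} [NeZero d] {m : ℤ} {X : ℕ → Site d} (h : ∃ n, m ≤ X n 0) :
    m ≤ X (hitTime m X) 0 := Nat.sInf_mem (s := {n | m ≤ X n 0}) h

lemma lt_of_lt_hitTime {d : ℕ} [NeZero d] {m : ℤ} {X : ℕ → Site d} {i : ℕ}
    (h : i < hitTime m X) : X i 0 < m := not_le.1 (Nat.notMem_of_lt_sInf h)

lemma hitTime_le {d : ℕ} [NeZero d] {m : ℤ} {X : ℕ → Site d} {i : ℕ} (h : m ≤ X i 0) :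
    hitTime m X ≤ i := Nat.sInf_le (s := {n | m ≤ X n 0}) h

lemma hitTime_mono {d : ℕ} [NeZero d] {m m' : ℤ} {X : ℕ → Site d} (hmm : m ≤ m')
    (h : ∃ n, m' ≤ X n 0) : hitTime m X ≤ hitTime m' X :=
  hitTime_le (hmm.trans (hitTime_spec h))

lemma hitTime_congr {d : ℕ} [NeZero d] {m : ℤ} {X Y : ℕ → Site d} {n : ℕ}
    (hX : ∃ k ≤ n, m ≤ X k 0) (hY : Y ∈ cyl n X) : hitTime m Y = hitTime m X := by
  obtain ⟨k, hk, hkm⟩ := hX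
  have h1 : hitTime m X ≤ n := (hitTime_le hkm).trans hk
  have h2 : hitTime m Y ≤ hitTime m X :=
    hitTime_le (by rw [hY _ h1]; exact hitTime_spec ⟨k, hkm⟩)
  refine le_antisymm h2 (hitTime_le ?_)
  rw [← hY _ (h2.trans h1)]
  exact hitTime_spec ⟨k, by rwa [hY k hk]⟩

/-- The event `S` is determined by the walk up to its first visit to the level `m`, which is
finite on `S`. -/
def IsStopped {d : ℕ} [NeZero d] (m : ℤ) (S : Set (ℕ → Site d)) : Prop :=
  ∀ X ∈ S, (∃ n, m ≤ X n 0) ∧ cyl (hitTime m X) X ⊆ S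

lemma IsStopped.eq_iUnion {d : ℕ} [NeZero d] {m : ℤ} (S : Set (ℕ → Site d)) :
    S = ⋃ N, S ∩ {X | hitTime m X = N} := by
  ext X; simp

lemma IsStopped.cyl_subset {d : ℕ} [NeZero d] {m : ℤ} {S : Set (ℕ → Site d)}
    (hS : IsStopped m S) (N : ℕ) : ∀ X ∈ S ∩ {X | hitTime m X = N},
      cyl N X ⊆ S ∩ {X | hitTime m X = N} := by
  rintro X ⟨hX, rfl⟩ Y hY
  obtain ⟨h1, h2⟩ := hS X hX
  exact ⟨h2 hY, hitTime_congr ⟨_, le_rfl, hitTime_spec h1⟩ hY⟩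

lemma IsStopped.measurableSet {d : ℕ} [NeZero d] {m : ℤ} {S : Set (ℕ → Site d)}
    (hS : IsStopped m S) : MeasurableSet S := by
  rw [IsStopped.eq_iUnion (m := m) S]
  exact MeasurableSet.iUnion fun N => measurableSet_of_cyl_subset (hS.cyl_subset N)

/-- Split `S` by the value of the hitting time; each piece is a union of cylinders of fixed length.
-/
lemma IsStopped.measure_le {d : ℕ} [NeZero d] {m : ℤ} {S : Set (ℕ → Site d)}
    (hS : IsStopped m S) (μ ν : Measure (ℕ → Site d))
    (h : ∀ X ∈ S, μ (cyl (hitTime m X) X) ≤ ν (cyl (hitTime m X) X)) : μ S ≤ ν S := by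
  rw [IsStopped.eq_iUnion (m := m) S]
  have hm : ∀ N, MeasurableSet (S ∩ {X | hitTime m X = N}) := fun N =>
    measurableSet_of_cyl_subset (hS.cyl_subset N)
  have hd : Pairwise (Function.onFun Disjoint fun N => S ∩ {X | hitTime m X = N}) := by
    intro N N' hNN'
    refine Set.disjoint_left.2 ?_
    rintro X ⟨_, rfl⟩ ⟨_, h'⟩
    exact hNN' h'
  rw [measure_iUnion hd hm, measure_iUnion hd hm]
  refine ENNReal.tsum_le_tsum fun N => measure_le_of_cyl μ ν (hS.cyl_subset N) ?_
  rintro X ⟨hX, rfl⟩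
  exact h X hX

/-- Within time `K` after its first visit to the level `m`, the walk visits the level `m + r` and
is tame for the following `L` steps. -/
def tameSoonAfter {d : ℕ} [NeZero d] (r c K L : ℕ) (m : ℤ) : Set (ℕ → Site d) :=
  {X | ∃ n, hitTime m X ≤ n ∧ n ≤ hitTime m X + K ∧ X n 0 = m + r ∧
    (fun s => X (n + s)) ∈ tameUpTo c L}

lemma abs_sub_le_of_steps {d : ℕ} {X : ℕ → Site d} (hX : ∀ n i, |X (n + 1) i - X n i| ≤ 1)
    (n k : ℕ) (i : Fin d) : |X (n + k) i - X n i| ≤ k := by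
  induction k with
  | zero => simp
  | succ k ih =>
    have h := hX (n + k) i
    rw [← add_assoc]
    push_cast
    rw [abs_le] at *
    omega

/-- Union bound over `K + 1` starting times and, as steps are of size at most one, `(2K + 1)^d`
starting sites. What matters is that `B` is chosen before `L`, `m` and `S`. -/
lemma exists_pathLaw_inter_tameSoonAfter_le {d : ℕ} [NeZero d] {r : ℕ} {P : Measure (Env d)}
    [IsProbabilityMeasure P] (hstat : IsStationary P) (hmix : MixingCondition r P) (c K : ℕ) :
    ∃ B : ℝ≥0∞, B ≠ ∞ ∧ ∀ (L : ℕ) (m : ℤ) (S : Set (ℕ → Site d)), IsStopped m S →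
      pathLaw P 0 (S ∩ tameSoonAfter r c K L m) ≤
        B * pathLaw P 0 (tameUpTo c L) * pathLaw P 0 S := by
  obtain ⟨B, hB, hle⟩ := exists_pathLaw_cyl_inter_tame_le hstat hmix c
  refine ⟨(((K + 1) * (2 * K + 1) ^ d : ℕ) : ℝ≥0∞) * B, ?_, fun L m S hS => ?_⟩
  · exact ENNReal.mul_ne_top (ENNReal.natCast_ne_top _) hB
  set δ := pathLaw P 0 (tameUpTo (d := d) c L)
  have := hS.measure_le ((pathLaw P 0).restrict (tameSoonAfter r c K L m))
    (((((K + 1) * (2 * K + 1) ^ d : ℕ) : ℝ≥0∞) * B * δ) • pathLaw P 0) ?_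
  · rwa [Measure.restrict_apply hS.measurableSet, Measure.smul_apply, smul_eq_mul] at this
  intro p hp
  set N := hitTime m p with hN
  rw [Measure.restrict_apply (measurableSet_cyl _ _), Measure.smul_apply, smul_eq_mul]
  set F : Finset (Site d) := Fintype.piFinset fun i => Finset.Icc (p N i - K) (p N i + K) with hF
  have hFcard : F.card = (2 * K + 1) ^ d := by
    rw [hF, Fintype.card_piFinset]
    have : ∀ i, (Finset.Icc (p N i - K) (p N i + K)).card = 2 * K + 1 := by
      intro i
      rw [Int.card_Icc]
      omega
    simp [this]
  have hsub : ∀ᵐ X ∂(pathLaw P 0), X ∈ cyl N p ∩ tameSoonAfter r c K L m →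
      X ∈ ⋃ k ∈ Finset.range (K + 1), ⋃ x ∈ F.filter fun x => x 0 = m + r,
        cyl N p ∩ {X | X (N + k) = x ∧ (fun s => X (N + k + s)) ∈ tameUpTo c L} := by
    filter_upwards [ae_steps_pathLaw P 0] with X hsteps
    rintro ⟨hX, n, hn1, hn2, hn3, hn4⟩
    rw [hitTime_congr ⟨_, le_rfl, hitTime_spec (hS p hp).1⟩ hX, ← hN] at hn1 hn2
    obtain ⟨k, rfl⟩ := Nat.exists_eq_add_of_le hn1
    refine Set.mem_biUnion (x := k) (by simp; omega) ?_
    refine Set.mem_biUnion (x := X (N + k)) ?_ ⟨hX, rfl, hn4⟩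
    simp only [Finset.coe_filter, Set.mem_ofPred_eq, hF, Fintype.mem_piFinset, Finset.mem_Icc]
    refine ⟨fun i => ?_, hn3⟩
    have h1 := abs_sub_le_of_steps hsteps N k i
    rw [hX N le_rfl, abs_le] at h1
    omega
  refine (measure_mono_ae hsub).trans ?_
  refine (measure_biUnion_finset_le _ _).trans ?_
  calc ∑ k ∈ Finset.range (K + 1), pathLaw P 0 (⋃ x ∈ F.filter fun x => x 0 = m + r,
        cyl N p ∩ {X | X (N + k) = x ∧ (fun s => X (N + k + s)) ∈ tameUpTo c L})
      ≤ ∑ k ∈ Finset.range (K + 1), ∑ x ∈ F, B * δ * pathLaw P 0 (cyl N p) := by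
        refine Finset.sum_le_sum fun k _ => (measure_biUnion_finset_le _ _).trans ?_
        refine le_trans (Finset.sum_le_sum fun x hx => ?_)
          (Finset.sum_le_sum_of_subset (Finset.filter_subset _ _))
        exact hle m N L k p x (fun i hi => lt_of_lt_hitTime hi) (Finset.mem_filter.1 hx).2
    _ ≤ _ := by
        rw [Finset.sum_const, Finset.sum_const, Finset.card_range, hFcard, nsmul_eq_mul,
          nsmul_eq_mul, Nat.cast_mul]
        exact le_of_eq (by ring)

/-! ### Tameness for ever and the time `R`. -/

lemma antitone_tameUpTo {d : ℕ} [NeZero d] (c : ℕ) : Antitone (tameUpTo (d := d) c) := by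
  intro L L' hLL' X hX
  refine ⟨fun s h1 h2 => hX.1 s h1 (h2.trans hLL'), fun j => (Finset.card_le_card ?_).trans (hX.2 j)⟩
  exact Finset.filter_subset_filter _ (Finset.range_mono hLL')

lemma iInter_tameUpTo {d : ℕ} [NeZero d] (c : ℕ) :
    ⋂ L, tameUpTo (d := d) c L = {X | timeR (c : ℝ) X = ⊤} := by
  ext X
  have hsum : ∀ n j : ℕ, ∑ i ∈ Finset.range n, (level X j).indicator (fun _ => (1 : ℝ)) (X i) =
      ((Finset.range n).filter fun i => X i 0 = X 0 0 + j).card := by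
    intro n j
    rw [Finset.card_filter]
    push_cast
    exact Finset.sum_congr rfl fun i _ => by simp [Set.indicator_apply, level]
  simp only [Set.mem_iInter, timeR, timeD, Set.mem_ofPred_eq, inf_eq_top_iff, iInf_eq_top,
    ENat.natCast_ne_top, imp_false, not_exists, not_lt, not_and, not_le, hsum]
  constructor
  · intro h
    exact ⟨fun n j => by exact_mod_cast (h (n + 1)).2 j, fun n hn => (h n).1 n hn le_rfl⟩
  · rintro ⟨h1, h2⟩ L
    refine ⟨fun s hs _ => h2 s hs, fun j => ?_⟩
    have := h1 L j
    have h3 : ((Finset.range (L + 1)).filter fun i => X i 0 = X 0 0 + j).card ≤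
        c * (j + 1) ^ 2 := by exact_mod_cast this
    exact (Finset.card_le_card (Finset.filter_subset_filter _
      (Finset.range_mono L.le_succ))).trans h3

lemma measurableSet_timeR_eq_top {d : ℕ} [NeZero d] (c : ℕ) :
    MeasurableSet {X : ℕ → Site d | timeR (c : ℝ) X = ⊤} := by
  rw [← iInter_tameUpTo]
  exact MeasurableSet.iInter fun L => measurableSet_of_cyl_subset (cyl_subset_tameUpTo c L)

lemma tendsto_pathLaw_tameUpTo {d : ℕ} [NeZero d] {P : Measure (Env d)} [IsProbabilityMeasure P]
    {c : ℕ} (h : pathLaw P 0 {X : ℕ → Site d | timeR (c : ℝ) X = ⊤} = 0) :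
    Tendsto (fun L => pathLaw P 0 (tameUpTo (d := d) c L)) atTop (nhds 0) := by
  rw [← h, ← iInter_tameUpTo]
  exact tendsto_measure_iInter_atTop
    (fun L => (measurableSet_of_cyl_subset (cyl_subset_tameUpTo c L)).nullMeasurableSet)
    (antitone_tameUpTo c) ⟨0, measure_ne_top _ _⟩

/-! ### Deterministic counting: a fast crossing contains many tame pieces. -/

lemma apply_hitTime {d : ℕ} [NeZero d] {m : ℤ} {X : ℕ → Site d}
    (hX : ∀ n i, |X (n + 1) i - X n i| ≤ 1) (h0 : X 0 0 ≤ m) (h : ∃ n, m ≤ X n 0) :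
    X (hitTime m X) 0 = m := by
  refine le_antisymm ?_ (hitTime_spec h)
  rcases Nat.eq_zero_or_pos (hitTime m X) with h1 | h1
  · rwa [h1]
  · obtain ⟨k, hk⟩ := Nat.exists_eq_add_of_le' h1
    have h2 : X k 0 < m := lt_of_lt_hitTime (by omega)
    have h3 := hX k 0
    rw [hk]
    rw [abs_le] at h3
    change X (k + 1) 0 ≤ m
    omega

/-- If the level `m + r` is not visited between the first visits to the levels `m + r + L` and
`m + r + L'`, then the walk is tame after its last visit to the level `m + r` before. -/
lemma mem_tameSoonAfter {d : ℕ} [NeZero d] {r c K L L' : ℕ} {m : ℤ} {X : ℕ → Site d}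
    (hX : ∀ n i, |X (n + 1) i - X n i| ≤ 1) (h0 : X 0 0 ≤ m) (hL : 1 ≤ L) (hLL' : L ≤ L')
    (hit : ∃ n, m + r + L' ≤ X n 0)
    (hno : ∀ t, hitTime (m + r + L) X ≤ t → t < hitTime (m + r + L') X → X t 0 ≠ m + r)
    (hK : hitTime (m + r + L) X ≤ hitTime m X + K)
    (hvis : ∀ j : ℕ, ((Finset.Ico (hitTime m X) (hitTime (m + r + L') X)).filter
      fun t => X t 0 = m + r + j).card ≤ c * (j + 1) ^ 2) :
    X ∈ tameSoonAfter r c K L' m := by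
  obtain ⟨n', hn'⟩ := hit
  have hitL : ∃ n, m + r + (L : ℤ) ≤ X n 0 := ⟨n', by omega⟩
  have hitr : ∃ n, m + (r : ℤ) ≤ X n 0 := ⟨n', by omega⟩
  have hr : X (hitTime (m + r) X) 0 = m + r := apply_hitTime hX (by omega) hitr
  have hlt : hitTime (m + r) X < hitTime (m + r + L) X := by
    refine lt_of_le_of_ne (hitTime_mono (by omega) hitL) fun he => ?_
    have := hitTime_spec hitL
    rw [← he, hr] at this
    omega
  -- `n` is the last visit to level `m + r` before level `m + r + L` is reached; by `hno` it is also
  -- the last one before level `m + r + L'` is.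
  obtain ⟨n, hn, hmax⟩ := Finset.exists_max_image
    ((Finset.range (hitTime (m + r + L) X)).filter fun t => X t 0 = m + r) id
    ⟨hitTime (m + r) X, by simp [hlt, hr]⟩
  simp only [Finset.mem_filter, Finset.mem_range, id] at hn hmax
  obtain ⟨hnL, hnr⟩ := hn
  have hmn : hitTime m X ≤ n := hitTime_le (by omega)
  have hnever : ∀ t, n < t → t < hitTime (m + r + L') X → X t 0 ≠ m + r := by
    intro t h1 h2 h3
    rcases lt_or_ge t (hitTime (m + r + L) X) with h | h
    · have := hmax t ⟨h, h3⟩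
      omega
    · exact hno t h h2 h3
  have hL'spec : m + r + (L' : ℤ) ≤ X (hitTime (m + r + L') X) 0 := hitTime_spec ⟨n', hn'⟩
  -- Backwards induction from the hitting time: with steps of size at most one, the walk cannot pass
  -- below `m + r` without visiting it.
  have habove : ∀ k t, t + k = hitTime (m + r + L') X → n < t → m + r < X t 0 := by
    intro k
    induction k with
    | zero =>
      intro t ht _
      rw [add_zero] at ht
      rw [ht]
      omega
    | succ k ih =>
      intro t ht hnt
      have h1 := ih (t + 1) (by omega) (by omega)
      have h2 := hX t 0
      have h3 := hnever t hnt (by omega)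
      rw [abs_le] at h2
      omega
  have hnL' : n < hitTime (m + r + L') X :=
    hnL.trans_le (hitTime_mono (by omega) ⟨n', hn'⟩)
  -- Climbing `L'` levels takes at least `L'` steps, so the tame stretch of length `L'` fits.
  have hlen : n + L' ≤ hitTime (m + r + L') X := by
    obtain ⟨k, hk⟩ := Nat.exists_eq_add_of_le hnL'.le
    have := abs_sub_le_of_steps hX n k 0
    rw [hk] at hL'spec ⊢
    rw [abs_le] at this
    omega
  refine ⟨n, hmn, by omega, hnr, fun s hs hsL => ?_, fun j => ?_⟩
  · simp only [add_zero, hnr]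
    exact habove (hitTime (m + r + L') X - (n + s)) _ (by omega) (by omega)
  · refine le_trans ?_ (hvis j)
    refine Finset.card_le_card_of_injOn (fun s => n + s) ?_ (fun _ _ _ _ h => by simpa using h)
    intro s hs
    simp only [Finset.coe_filter, Finset.mem_range, Set.mem_ofPred_eq, add_zero, hnr] at hs
    simp only [Finset.coe_filter, Finset.mem_Ico, Set.mem_ofPred_eq]
    exact ⟨by omega, hs.2⟩

/-- Telescoping: raising the shift by one adds a single difference of two values of `g`, at most `b
- a`. -/
lemma sum_sub_le_mul {g : ℕ → ℕ} {a b : ℕ} (n h : ℕ) (hlo : ∀ k ≤ n + h, a ≤ g k)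
    (hhi : ∀ k ≤ n + h, g k ≤ b) :
    ∑ k ∈ Finset.range n, ((g (k + h) : ℤ) - g k) ≤ h * ((b : ℤ) - a) := by
  induction h with
  | zero => simp
  | succ h ih =>
    have h1 := ih (fun k hk => hlo k (by omega)) (fun k hk => hhi k (by omega))
    have h2 : ∑ k ∈ Finset.range n, ((g (k + (h + 1)) : ℤ) - g k) =
        ∑ k ∈ Finset.range n, ((g (k + h) : ℤ) - g k) + ((g (n + h) : ℤ) - g (0 + h)) := by
      rw [← Finset.sum_range_sub (fun k => (g (k + h) : ℤ)), ← Finset.sum_add_distrib]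
      refine Finset.sum_congr rfl fun k _ => ?_
      rw [show k + (h + 1) = k + 1 + h by ring]
      ring
    have h3 := hhi (n + h) (by omega)
    have h4 := hlo (0 + h) (by omega)
    rw [h2]
    push_cast
    rw [add_mul, one_mul]
    zify at h3 h4
    linarith

/-- The number of `k` such that some increment of `g` over `h` steps from `k` exceeds `K`. -/
lemma card_increment_gt_mul_le {g : ℕ → ℕ} {a b : ℕ} (n h K : ℕ)
    (hg : ∀ k k', k ≤ k' → k' ≤ n + h → g k ≤ g k') (hlo : a ≤ g 0) (hhi : g (n + h) ≤ b) :
    ((Finset.range n).filter fun k => g k + K < g (k + h)).card * K ≤ h * (b - a) := by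
  have hab : a ≤ b := hlo.trans ((hg 0 (n + h) (Nat.zero_le _) le_rfl).trans hhi)
  have h1 := sum_sub_le_mul (g := g) (a := a) (b := b) n h
    (fun k hk => hlo.trans (hg 0 k (Nat.zero_le _) hk)) (fun k hk => (hg k _ hk le_rfl).trans hhi)
  have h2 : (((Finset.range n).filter fun k => g k + K < g (k + h)).card : ℤ) * K ≤
      ∑ k ∈ Finset.range n, ((g (k + h) : ℤ) - g k) := by
    calc (((Finset.range n).filter fun k => g k + K < g (k + h)).card : ℤ) * K
        ≤ ∑ k ∈ (Finset.range n).filter fun k => g k + K < g (k + h), ((g (k + h) : ℤ) - g k) := by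
          rw [← nsmul_eq_mul]
          refine Finset.card_nsmul_le_sum _ _ _ fun k hk => ?_
          have := (Finset.mem_filter.1 hk).2
          omega
      _ ≤ _ := by
          refine Finset.sum_le_sum_of_subset_of_nonneg (Finset.filter_subset _ _) fun k hk _ => ?_
          have := hg k (k + h) (by omega) (by have := Finset.mem_range.1 hk; omega)
          omega
  have h3 := h2.trans h1
  rw [← Nat.cast_sub hab] at h3
  exact_mod_cast h3

open Classical in
-- Charge each bad `q` to a level `l = q + j` that spoils it. Then `c (l - q + 1) ≤ N l`, so `l` is
-- charged at most `N l / c` times.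
lemma card_exists_sq_lt_mul_le {N : ℕ → ℕ} {M c : ℕ} (hc : 0 < c) (hN : ∀ l, M ≤ l → N l = 0) :
    ((Finset.range M).filter fun q => ∃ j, c * (j + 1) ^ 2 < N (q + j)).card * c ≤
      ∑ l ∈ Finset.range M, N l := by
  have hsub : ((Finset.range M).filter fun q => ∃ j, c * (j + 1) ^ 2 < N (q + j)) ⊆
      (Finset.range M).biUnion fun l =>
        (Finset.range M).filter fun q => q ≤ l ∧ c * (l - q + 1) ^ 2 < N l := by
    intro q hq
    obtain ⟨hqM, j, hj⟩ := Finset.mem_filter.1 hq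
    refine Finset.mem_biUnion.2 ⟨q + j, ?_, Finset.mem_filter.2 ⟨hqM, by omega, ?_⟩⟩
    · rw [Finset.mem_range]
      by_contra hlt
      rw [hN _ (not_lt.1 hlt)] at hj
      omega
    · rwa [Nat.add_sub_cancel_left]
  calc _ ≤ (∑ l ∈ Finset.range M,
        ((Finset.range M).filter fun q => q ≤ l ∧ c * (l - q + 1) ^ 2 < N l).card) * c :=
        Nat.mul_le_mul_right _ ((Finset.card_le_card hsub).trans Finset.card_biUnion_le)
    _ ≤ _ := by
        rw [Finset.sum_mul]
        refine Finset.sum_le_sum fun l _ => ?_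
        refine le_trans (Nat.mul_le_mul_right c ?_) (Nat.div_mul_le_self (N l) c)
        rw [← Finset.card_range (N l / c)]
        refine Finset.card_le_card_of_injOn (fun q => l - q) ?_ ?_
        · intro q hq
          simp only [Finset.coe_filter, Set.mem_ofPred_eq] at hq
          simp only [Finset.coe_range, Set.mem_Iio]
          refine (Nat.le_div_iff_mul_le hc).2 ?_
          have h1 : (l - q + 1) ≤ (l - q + 1) ^ 2 := Nat.le_self_pow (by norm_num) _
          calc (l - q + 1) * c = c * (l - q + 1) := mul_comm _ _
            _ ≤ c * (l - q + 1) ^ 2 := Nat.mul_le_mul_left _ h1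
            _ ≤ N l := hq.2.2.le
        · intro q hq q' hq' h
          simp only [Finset.coe_filter, Set.mem_ofPred_eq] at hq hq' h
          omega

open Classical in
/-- If the walk crosses `M` levels within time `A M`, then at least half of the levels are
followed by a tame piece of path, at one of the scales `Ls i`. -/
lemma le_two_mul_card_tameSoonAfter {d : ℕ} [NeZero d] {r A M : ℕ} {a : ℤ} {Ls Ks : ℕ → ℕ}
    {X : ℕ → Site d} (hX : ∀ n i, |X (n + 1) i - X n i| ≤ 1) (h0 : X 0 0 ≤ a) (hA : 1 ≤ A)
    (hLs : Monotone Ls) (hLs0 : 1 ≤ Ls 0)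
    (hKs : ∀ i, 8 * (8 * A + 1) * A * (r + Ls i) ≤ Ks i) (hM : 4 * (r + Ls (8 * A + 1)) ≤ M)
    (hit : ∃ n, a + M ≤ X n 0) (hquick : hitTime (a + M) X ≤ hitTime a X + A * M) :
    M ≤ 2 * (Finset.filter (fun k : ℕ => ∃ i < 8 * A + 1,
      X ∈ tameSoonAfter r (8 * A) (Ks i) (Ls (i + 1)) (a + k)) (Finset.range M)).card := by
  set c := 8 * A with hc
  set g : ℕ → ℕ := fun k => hitTime (a + k) X with hg
  have hitk : ∀ k ≤ M, ∃ n, a + (k : ℤ) ≤ X n 0 := by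
    obtain ⟨n, hn⟩ := hit
    exact fun k hk => ⟨n, by omega⟩
  have hgmono : ∀ k k', k ≤ k' → k' ≤ M → g k ≤ g k' := fun k k' hkk hk' =>
    hitTime_mono (by omega) (hitk k' hk')
  have hg0 : g 0 = hitTime a X := by simp [hg]
  set N : ℕ → ℕ := fun l => ((Finset.Ico (g 0) (g M)).filter fun t => X t 0 = a + l).card with hN
  have hN0 : ∀ l, M ≤ l → N l = 0 := by
    intro l hl
    rw [hN, Finset.card_eq_zero, Finset.filter_eq_empty_iff]
    intro t ht h
    have := lt_of_lt_hitTime (Finset.mem_Ico.1 ht).2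
    omega
  have hNsum : ∑ l ∈ Finset.range M, N l ≤ A * M := by
    rw [← Finset.card_biUnion]
    · refine (Finset.card_le_card (Finset.biUnion_subset.2 fun l _ =>
        Finset.filter_subset _ _)).trans ?_
      rw [Nat.card_Ico, hg0]
      have : g M = hitTime (a + M) X := rfl
      omega
    · intro l _ l' _ hll'
      refine Finset.disjoint_left.2 fun t ht ht' => hll' ?_
      have h1 := (Finset.mem_filter.1 ht).2
      have h2 := (Finset.mem_filter.1 ht').2
      omega
  set Good := Finset.filter (fun k : ℕ => ∃ i < c + 1,
      X ∈ tameSoonAfter r c (Ks i) (Ls (i + 1)) (a + k)) (Finset.range M) with hGood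
  -- The exceptional levels are `Far` (at most `M/4`), `Dense` (at most `M/8`, because `c = 8A`) and
  -- the `Slow i` (at most `M/8` in total, by the choice of `Ks`), hence at most half of all.
  set H := r + Ls (c + 1) with hH
  set Far := Finset.Ico (M - H) M with hFar
  set Slow : ℕ → Finset ℕ := fun i =>
    (Finset.range (M - (r + Ls i))).filter fun k => g k + Ks i < g (k + (r + Ls i)) with hSlow
  set Dense := (Finset.range M).filter fun k => ∃ j, c * (j + 1) ^ 2 < N (k + r + j) with hDense
  have hFarcard : 4 * Far.card ≤ M := by
    rw [hFar, Nat.card_Ico]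
    omega
  have hDensecard : 8 * Dense.card ≤ M := by
    have h1 := card_exists_sq_lt_mul_le (N := N) (M := M) (c := c) (by omega) hN0
    have h2 : Dense.card ≤
        ((Finset.range M).filter fun q => ∃ j, c * (j + 1) ^ 2 < N (q + j)).card := by
      refine Finset.card_le_card_of_injOn (fun k => k + r) ?_ (fun _ _ _ _ h => by simpa using h)
      intro k hk
      obtain ⟨_, j, hj⟩ := Finset.mem_filter.1 (Finset.mem_coe.1 hk)
      simp only [Finset.coe_filter, Set.mem_ofPred_eq, Finset.mem_range]
      refine ⟨?_, j, hj⟩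
      by_contra hlt
      rw [hN0 _ (by omega)] at hj
      omega
    have h3 : (8 * Dense.card) * A ≤ M * A := by
      calc (8 * Dense.card) * A = Dense.card * c := by rw [hc]; ring
        _ ≤ _ := (Nat.mul_le_mul_right c h2).trans (h1.trans hNsum)
        _ = M * A := mul_comm _ _
    exact Nat.le_of_mul_le_mul_right h3 hA
  have hSlowcard : ∀ i < c + 1, 8 * (c + 1) * (Slow i).card ≤ M := by
    intro i hi
    have hLi : Ls i ≤ Ls (c + 1) := hLs hi.le
    have h1 := card_increment_gt_mul_le (g := g) (a := g 0) (b := g M) (M - (r + Ls i)) (r + Ls i)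
      (Ks i) (fun k k' h h' => hgmono k k' h (by omega)) le_rfl
      (by rw [Nat.sub_add_cancel (by omega)])
    have h2 : g M - g 0 ≤ A * M := by
      have : g M = hitTime (a + M) X := rfl
      omega
    have hpos : 0 < A * (r + Ls i) := by
      have := hLs (Nat.zero_le i)
      exact Nat.mul_pos hA (by omega)
    refine Nat.le_of_mul_le_mul_right (?_ : _ * (A * (r + Ls i)) ≤ _ * (A * (r + Ls i))) hpos
    calc 8 * (c + 1) * (Slow i).card * (A * (r + Ls i))
        = (Slow i).card * (8 * (c + 1) * A * (r + Ls i)) := by ring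
      _ ≤ (Slow i).card * Ks i := Nat.mul_le_mul_left _ (hKs i)
      _ ≤ (r + Ls i) * (g M - g 0) := h1
      _ ≤ (r + Ls i) * (A * M) := Nat.mul_le_mul_left _ h2
      _ = M * (A * (r + Ls i)) := by ring
  have hSlowunion : 8 * ((Finset.range (c + 1)).biUnion Slow).card ≤ M := by
    have h1 : ((Finset.range (c + 1)).biUnion Slow).card ≤
        ∑ i ∈ Finset.range (c + 1), (Slow i).card := Finset.card_biUnion_le
    have h2 : ∑ i ∈ Finset.range (c + 1), 8 * (c + 1) * (Slow i).card ≤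
        ∑ _i ∈ Finset.range (c + 1), M :=
      Finset.sum_le_sum fun i hi => hSlowcard i (Finset.mem_range.1 hi)
    rw [← Finset.mul_sum, Finset.sum_const, Finset.card_range, smul_eq_mul] at h2
    refine Nat.le_of_mul_le_mul_left (?_ : (c + 1) * _ ≤ (c + 1) * _) (Nat.succ_pos c)
    refine le_trans ?_ h2
    calc (c + 1) * (8 * ((Finset.range (c + 1)).biUnion Slow).card)
        = 8 * (c + 1) * ((Finset.range (c + 1)).biUnion Slow).card := by ring
      _ ≤ _ := Nat.mul_le_mul_left _ h1
  have hcover : Finset.range M ⊆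
      Good ∪ (Far ∪ (Dense ∪ (Finset.range (c + 1)).biUnion Slow)) := by
    intro k hk
    have hkM := Finset.mem_range.1 hk
    by_contra hnot
    simp only [Finset.mem_union, not_or, Finset.mem_biUnion, not_exists, not_and] at hnot
    obtain ⟨hnGood, hnFar, hnDense, hnSlow⟩ := hnot
    have hkH : k + H < M := by
      by_contra hlt
      exact hnFar (Finset.mem_Ico.2 ⟨by omega, hkM⟩)
    have hdens : ∀ j, N (k + r + j) ≤ c * (j + 1) ^ 2 := by
      intro j
      by_contra hlt
      exact hnDense (Finset.mem_filter.2 ⟨hk, j, not_le.1 hlt⟩)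
    have hLe : ∀ i ≤ c + 1, k + (r + Ls i) ≤ M := fun i hi => by
      have := hLs hi
      omega
    have hlev : ∀ i, a + (k : ℤ) + r + Ls i = a + ((k + (r + Ls i) : ℕ) : ℤ) := fun i => by
      push_cast; ring
    have hfast : ∀ i < c + 1, g (k + (r + Ls i)) ≤ g k + Ks i := by
      intro i hi
      by_contra hlt
      have h1 := hLs (show i ≤ c + 1 from hi.le)
      exact hnSlow i (Finset.mem_range.2 hi)
        (Finset.mem_filter.2 ⟨Finset.mem_range.2 (by omega), not_le.1 hlt⟩)
    -- Failure at scale `i` forces a return to level `a + k + r` in the `i`-th window. The `c + 1`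
    -- windows are disjoint, while `hdens 0` allows only `c` visits.
    have hvisit : ∀ i < c + 1, ∃ t, g (k + (r + Ls i)) ≤ t ∧ t < g (k + (r + Ls (i + 1))) ∧
        X t 0 = a + k + r := by
      intro i hi
      by_contra hno
      push Not at hno
      refine hnGood (Finset.mem_filter.2 ⟨hk, i, hi, ?_⟩)
      refine mem_tameSoonAfter hX (by omega) (hLs0.trans (hLs (Nat.zero_le i)))
        (hLs i.le_succ) ?_ ?_ ?_ ?_
      · rw [hlev]
        exact hitk _ (hLe _ hi)
      · intro t h1 h2
        rw [hlev] at h1 h2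
        exact hno t h1 h2
      · rw [hlev]
        exact hfast i hi
      · intro j
        refine le_trans (Finset.card_le_card ?_) (hdens j)
        intro t ht
        simp only [Finset.mem_filter, Finset.mem_Ico, hlev] at ht ⊢
        have h1 : g 0 ≤ g k := hgmono 0 k (Nat.zero_le _) hkM.le
        have h2 : g (k + (r + Ls (i + 1))) ≤ g M := hgmono _ _ (hLe _ hi) le_rfl
        refine ⟨⟨h1.trans ht.1.1, ht.1.2.trans_le h2⟩, ?_⟩
        push_cast
        linarith [ht.2]
    choose! v hv1 hv2 hv3 using hvisit
    have hcard : (Finset.range (c + 1)).card ≤ N (k + r + 0) := by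
      refine Finset.card_le_card_of_injOn v ?_ ?_
      · intro i hi
        have hi' := Finset.mem_range.1 (Finset.mem_coe.1 hi)
        simp only [Finset.coe_filter, Finset.mem_Ico, Set.mem_ofPred_eq]
        refine ⟨⟨?_, ?_⟩, ?_⟩
        · exact (hgmono 0 _ (Nat.zero_le _) (hLe i hi'.le)).trans (hv1 i hi')
        · exact (hv2 i hi').trans_le (hgmono _ _ (hLe (i + 1) hi') le_rfl)
        · rw [hv3 i hi']
          push_cast
          ring
      · have hlt : ∀ i j, i < j → j < c + 1 → v i < v j := by
          intro i j hij hj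
          refine (hv2 i (hij.trans hj)).trans_le (le_trans ?_ (hv1 j hj))
          exact hgmono _ _ (by have := hLs (show i + 1 ≤ j from hij); omega) (hLe j hj.le)
        intro i hi j hj hvij
        have hi' := Finset.mem_range.1 (Finset.mem_coe.1 hi)
        have hj' := Finset.mem_range.1 (Finset.mem_coe.1 hj)
        rcases lt_trichotomy i j with h | h | h
        · have := hlt i j h hj'; omega
        · exact h
        · have := hlt j i h hi'; omega
    have h1 := hdens 0
    rw [Finset.card_range] at hcard
    omega
  have hfinal := (Finset.card_le_card hcover).trans ((Finset.card_union_le _ _).trans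
    (Nat.add_le_add_left ((Finset.card_union_le _ _).trans
      (Nat.add_le_add_left (Finset.card_union_le _ _) _)) _))
  rw [Finset.card_range] at hfinal
  omega

/-! ### Choice of scales and the block estimate. -/

lemma IsStopped.inter_hits {d : ℕ} [NeZero d] {a m : ℤ} {S : Set (ℕ → Site d)}
    (hS : IsStopped a S) (ham : a ≤ m) : IsStopped m (S ∩ {X | ∃ n, m ≤ X n 0}) := by
  rintro X ⟨hX, hm⟩
  refine ⟨hm, fun Y hY => ⟨(hS X hX).2 fun i hi => hY i (hi.trans (hitTime_mono ham hm)),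
    hitTime m X, ?_⟩⟩
  rw [hY _ le_rfl]
  exact hitTime_spec hm

/-- If no `timeR c` is infinite with positive probability, there are scales at which tame pieces
of path are unlikely, conditionally on the past. -/
lemma exists_scales {d : ℕ} [NeZero d] {r : ℕ} {P : Measure (Env d)} [IsProbabilityMeasure P]
    (hstat : IsStationary P) (hmix : MixingCondition r P) {c : ℕ}
    (hR : pathLaw P 0 {X : ℕ → Site d | timeR (c : ℝ) X = ⊤} = 0) (b : ℕ) {ε : ℝ≥0∞}
    (hε : ε ≠ 0) :
    ∃ Ls : ℕ → ℕ, Monotone Ls ∧ 1 ≤ Ls 0 ∧ ∀ (i : ℕ) (m : ℤ) (S : Set (ℕ → Site d)),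
      IsStopped m S →
      pathLaw P 0 (S ∩ tameSoonAfter r c (b * (r + Ls i)) (Ls (i + 1)) m) ≤ ε * pathLaw P 0 S := by
  -- The window, and with it the constant `B`, is fixed by the current scale; the next scale is then
  -- taken so large that tameness beats `B`. The scales are iterates of this choice.
  have hnext : ∀ L : ℕ, ∃ L', L ≤ L' ∧ ∀ (m : ℤ) (S : Set (ℕ → Site d)), IsStopped m S →
      pathLaw P 0 (S ∩ tameSoonAfter r c (b * (r + L)) L' m) ≤ ε * pathLaw P 0 S := by
    intro L
    obtain ⟨B, hB, hle⟩ := exists_pathLaw_inter_tameSoonAfter_le hstat hmix c (b * (r + L))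
    have htend : Tendsto (fun L => B * pathLaw P 0 (tameUpTo (d := d) c L)) atTop (nhds 0) := by
      have := ENNReal.Tendsto.const_mul (tendsto_pathLaw_tameUpTo hR) (Or.inr hB)
      rwa [mul_zero] at this
    obtain ⟨L', hL', hLL'⟩ := ((htend.eventually (gt_mem_nhds (pos_iff_ne_zero.2 hε))).and
      (eventually_ge_atTop L)).exists
    exact ⟨L', hLL', fun m S hS => (hle L' m S hS).trans (mul_le_mul_left hL'.le _)⟩
  choose φ hφ1 hφ2 using hnext
  refine ⟨fun n => φ^[n] 1, monotone_nat_of_le_succ fun n => ?_, le_rfl, fun i m S hS => ?_⟩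
  · rw [Function.iterate_succ_apply']
    exact hφ1 _
  · simp only [Function.iterate_succ_apply']
    exact hφ2 _ m S hS

/-- Conditionally on the past, crossing a block of `M` levels within time `A M` is unlikely. -/
lemma exists_block {d : ℕ} [NeZero d] {r : ℕ} {P : Measure (Env d)} [IsProbabilityMeasure P]
    (hstat : IsStationary P) (hmix : MixingCondition r P) {A : ℕ} (hA : 1 ≤ A)
    (hR : pathLaw P 0 {X : ℕ → Site d | timeR ((8 * A : ℕ) : ℝ) X = ⊤} = 0) :
    ∃ M : ℕ, 1 ≤ M ∧ ∀ (a : ℤ) (S : Set (ℕ → Site d)), 0 ≤ a → IsStopped a S →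
      pathLaw P 0 (S ∩ {X | (∃ n, a + M ≤ X n 0) ∧
        hitTime (a + M) X ≤ hitTime a X + A * M}) ≤ 16⁻¹ * pathLaw P 0 S := by
  classical
  set I := 8 * A + 1 with hI
  -- Summing `1/(32 I)` over the `I` scales gives `1/32` per level; needing half of the levels
  -- doubles this to `1/16`.
  obtain ⟨Ls, hLs, hLs0, hrare⟩ := exists_scales hstat hmix hR (8 * I * A)
    (ε := ((32 * I : ℕ) : ℝ≥0∞)⁻¹) (ENNReal.inv_ne_zero.2 (ENNReal.natCast_ne_top _))
  set M := 4 * (r + Ls I) with hM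
  have hLsI := hLs (Nat.zero_le I)
  refine ⟨M, by omega, fun a S ha hS => ?_⟩
  set Q := pathLaw P 0 with hQ
  set F : ℕ → Set (ℕ → Site d) := fun k => {X | ∃ i < I,
      X ∈ tameSoonAfter r (8 * A) (8 * I * A * (r + Ls i)) (Ls (i + 1)) (a + k)} with hF
  -- Measurable hulls have the same measure, so Markov's inequality applies without measurability of
  -- `F k`.
  set G : ℕ → Set (ℕ → Site d) := fun k =>
    toMeasurable Q ((S ∩ {X | ∃ n, a + (k : ℤ) ≤ X n 0}) ∩ F k) with hG
  have hGm : ∀ k, MeasurableSet (G k) := fun k => measurableSet_toMeasurable _ _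
  have hGQ : ∀ k, Q (G k) ≤ 32⁻¹ * Q S := by
    intro k
    rw [hG, measure_toMeasurable]
    have hsub : (S ∩ {X | ∃ n, a + (k : ℤ) ≤ X n 0}) ∩ F k ⊆ ⋃ i ∈ Finset.range I,
        (S ∩ {X | ∃ n, a + (k : ℤ) ≤ X n 0}) ∩
          tameSoonAfter r (8 * A) (8 * I * A * (r + Ls i)) (Ls (i + 1)) (a + k) := by
      rintro X ⟨hX, i, hi, hXi⟩
      exact Set.mem_biUnion (x := i) (by simpa using hi) ⟨hX, hXi⟩
    refine (measure_mono hsub).trans ((measure_biUnion_finset_le _ _).trans ?_)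
    calc _ ≤ ∑ i ∈ Finset.range I, ((32 * I : ℕ) : ℝ≥0∞)⁻¹ * Q S := by
          refine Finset.sum_le_sum fun i _ => ?_
          refine (hrare i _ _ (hS.inter_hits (by omega))).trans ?_
          exact mul_le_mul_right (measure_mono Set.inter_subset_left) _
      _ = _ := by
          rw [Finset.sum_const, Finset.card_range, nsmul_eq_mul, ← mul_assoc]
          congr 1
          rw [Nat.cast_mul, ENNReal.mul_inv (by simp) (by simp), mul_left_comm,
            ENNReal.mul_inv_cancel (by simp [hI]) (by simp), mul_one]
          norm_num
  have hcount : ∀ᵐ X ∂Q, X ∈ S ∩ {X | (∃ n, a + M ≤ X n 0) ∧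
      hitTime (a + M) X ≤ hitTime a X + A * M} →
      X ∈ {X | (M : ℝ≥0∞) ≤ 2 * ∑ k ∈ Finset.range M, (G k).indicator 1 X} := by
    filter_upwards [ae_steps_pathLaw P 0, ae_start_pathLaw P 0] with X hsteps h0
    rintro ⟨hXS, ⟨n, hn⟩, hquick⟩
    have h := le_two_mul_card_tameSoonAfter (Ks := fun i => 8 * I * A * (r + Ls i)) hsteps
      (by rw [h0]; exact ha) hA hLs hLs0 (fun i => le_rfl) hM.ge ⟨n, hn⟩ hquick
    have h2 : (((Finset.range M).filter fun k => X ∈ F k).card : ℝ≥0∞) ≤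
        ∑ k ∈ Finset.range M, (G k).indicator 1 X := by
      rw [Finset.card_filter]
      push_cast
      refine Finset.sum_le_sum fun k hk => ?_
      split_ifs with hXk
      · rw [Set.indicator_of_mem]
        · rfl
        · refine subset_toMeasurable _ _ ⟨⟨hXS, n, ?_⟩, hXk⟩
          have := Finset.mem_range.1 hk
          omega
      · exact zero_le
    have h3 : (M : ℝ≥0∞) ≤ 2 * (((Finset.range M).filter fun k => X ∈ F k).card : ℝ≥0∞) := by
      have h4 : M ≤ 2 * ((Finset.range M).filter fun k => X ∈ F k).card := by
        convert h using 3
        exact Finset.filter_congr fun _ _ => Iff.rfl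
      exact_mod_cast h4
    exact h3.trans (mul_le_mul_right h2 _)
  have hint : ∫⁻ X, 2 * ∑ k ∈ Finset.range M, (G k).indicator 1 X ∂Q ≤ M * (16⁻¹ * Q S) := by
    have hmeas : ∀ k ∈ Finset.range M, Measurable ((G k).indicator (1 : (ℕ → Site d) → ℝ≥0∞)) :=
      fun k _ => measurable_one.indicator (hGm k)
    rw [lintegral_const_mul _ (Finset.measurable_fun_sum _ hmeas),
      lintegral_finsetSum _ hmeas]
    calc 2 * ∑ k ∈ Finset.range M, ∫⁻ X, (G k).indicator 1 X ∂Q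
        ≤ 2 * ∑ _k ∈ Finset.range M, 32⁻¹ * Q S := by
          refine mul_le_mul_right (Finset.sum_le_sum fun k _ => ?_) _
          rw [lintegral_indicator_one (hGm k)]
          exact hGQ k
      _ = M * ((2 * 32⁻¹) * Q S) := by
          rw [Finset.sum_const, Finset.card_range, nsmul_eq_mul]
          ring
      _ = M * (16⁻¹ * Q S) := by
          rw [show (32 : ℝ≥0∞) = 2 * 16 by norm_num, ENNReal.mul_inv (by simp) (by simp),
            ← mul_assoc 2, ENNReal.mul_inv_cancel (by simp) (by simp), one_mul]
  have hM0 : (M : ℝ≥0∞) ≠ 0 := by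
    have : M ≠ 0 := by omega
    exact_mod_cast this
  have hmarkov := mul_meas_ge_le_lintegral (μ := Q)
    (f := fun X => 2 * ∑ k ∈ Finset.range M, (G k).indicator 1 X)
    ((Finset.measurable_fun_sum _ fun k _ => measurable_one.indicator (hGm k)).const_mul 2)
    (M : ℝ≥0∞)
  refine (measure_mono_ae hcount).trans ?_
  exact (ENNReal.mul_le_mul_iff_right hM0 (ENNReal.natCast_ne_top M)).1 (hmarkov.trans hint)

/-! ### Counting quickly crossed blocks and the vanishing of the speed. -/

/-- The number of blocks, among the first `n` blocks of `M` levels, which are crossed within time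
`A M`. -/
noncomputable def quickCount {d : ℕ} [NeZero d] (A M n : ℕ) (X : ℕ → Site d) : ℕ :=
  ((Finset.range n).filter fun i => hitTime (((i + 1) * M : ℕ) : ℤ) X ≤
    hitTime ((i * M : ℕ) : ℤ) X + A * M).card

lemma quickCount_succ {d : ℕ} [NeZero d] (A M n : ℕ) (X : ℕ → Site d) :
    quickCount A M (n + 1) X = quickCount A M n X +
      if hitTime (((n + 1) * M : ℕ) : ℤ) X ≤ hitTime ((n * M : ℕ) : ℤ) X + A * M then 1 else 0 := by
  rw [quickCount, quickCount, Finset.range_add_one, Finset.filter_insert]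
  split_ifs
  · rw [Finset.card_insert_of_notMem (by simp)]
  · rfl

/-- Each block that is not quick costs more than `A M` units of time. -/
lemma mul_le_hitTime_add_quickCount {d : ℕ} [NeZero d] (A M n : ℕ) (X : ℕ → Site d) :
    (∃ k, ((n * M : ℕ) : ℤ) ≤ X k 0) →
    n * (A * M) ≤ hitTime ((n * M : ℕ) : ℤ) X + quickCount A M n X * (A * M) := by
  induction n with
  | zero => simp
  | succ n ih =>
    rintro hit
    have hle : ((n * M : ℕ) : ℤ) ≤ (((n + 1) * M : ℕ) : ℤ) := by
      exact_mod_cast Nat.mul_le_mul_right M n.le_succ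
    have h1 := ih (hit.imp fun k hk => hle.trans hk)
    have h2 := hitTime_mono hle hit
    rw [quickCount_succ]
    split_ifs with h
    · rw [add_mul n, add_mul (quickCount A M n X)]
      omega
    · rw [add_mul n, add_zero]
      omega

lemma isStopped_quickCount {d : ℕ} [NeZero d] (A M n j : ℕ) :
    IsStopped (d := d) ((n * M : ℕ) : ℤ)
      {X | (∃ k, ((n * M : ℕ) : ℤ) ≤ X k 0) ∧ j ≤ quickCount A M n X} := by
  rintro X ⟨hit, hj⟩
  refine ⟨hit, fun Y hY => ⟨⟨hitTime _ X, by rw [hY _ le_rfl]; exact hitTime_spec hit⟩, ?_⟩⟩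
  have hT : ∀ i ≤ n, hitTime ((i * M : ℕ) : ℤ) Y = hitTime ((i * M : ℕ) : ℤ) X := fun i hi =>
    hitTime_congr ⟨_, le_rfl, le_trans
      (by exact_mod_cast Nat.mul_le_mul_right M hi) (hitTime_spec hit)⟩ hY
  refine hj.trans (le_of_eq ?_)
  rw [quickCount, quickCount]
  congr 1
  refine Finset.filter_congr fun i hi => ?_
  have hi' := Finset.mem_range.1 hi
  rw [hT i hi'.le, hT (i + 1) hi']

/-- Induction on `n`: either the quick blocks are already among the first `n`, or the last block is
quick, at conditional cost `1/16`. The two terms are equal, whence the factor `2` per block. -/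
lemma pathLaw_quickCount_le {d : ℕ} [NeZero d] {P : Measure (Env d)} [IsProbabilityMeasure P]
    {A M : ℕ} (hblock : ∀ (a : ℤ) (S : Set (ℕ → Site d)), 0 ≤ a → IsStopped a S →
      pathLaw P 0 (S ∩ {X | (∃ n, a + M ≤ X n 0) ∧
        hitTime (a + M) X ≤ hitTime a X + A * M}) ≤ 16⁻¹ * pathLaw P 0 S) (n j : ℕ) :
    pathLaw P 0 {X | (∃ k, ((n * M : ℕ) : ℤ) ≤ X k 0) ∧ j ≤ quickCount A M n X} ≤
      2 ^ n * 16⁻¹ ^ j := by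
  induction n generalizing j with
  | zero =>
    rcases Nat.eq_zero_or_pos j with rfl | hj
    · simpa using prob_le_one
    · have : {X : ℕ → Site d | (∃ k, ((0 * M : ℕ) : ℤ) ≤ X k 0) ∧ j ≤ quickCount A M 0 X} = ∅ := by
        ext X
        simp [quickCount, hj.ne']
      rw [this, measure_empty]
      exact zero_le
  | succ n ih =>
    rcases Nat.eq_zero_or_pos j with rfl | hj
    · rw [pow_zero, mul_one]
      exact prob_le_one.trans (one_le_pow₀ (by norm_num))
    · obtain ⟨j, rfl⟩ := Nat.exists_eq_add_of_le' hj
      have hlev : (((n + 1) * M : ℕ) : ℤ) = ((n * M : ℕ) : ℤ) + M := by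
        push_cast; ring
      have hsub : {X : ℕ → Site d | (∃ k, (((n + 1) * M : ℕ) : ℤ) ≤ X k 0) ∧
          j + 1 ≤ quickCount A M (n + 1) X} ⊆
          {X | (∃ k, ((n * M : ℕ) : ℤ) ≤ X k 0) ∧ j + 1 ≤ quickCount A M n X} ∪
          ({X | (∃ k, ((n * M : ℕ) : ℤ) ≤ X k 0) ∧ j ≤ quickCount A M n X} ∩
            {X | (∃ k, ((n * M : ℕ) : ℤ) + M ≤ X k 0) ∧
              hitTime (((n * M : ℕ) : ℤ) + M) X ≤ hitTime ((n * M : ℕ) : ℤ) X + A * M}) := by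
        rintro X ⟨⟨k, hk⟩, hj⟩
        rw [quickCount_succ] at hj
        rw [hlev] at hk hj
        have hk' : ((n * M : ℕ) : ℤ) ≤ X k 0 := by omega
        split_ifs at hj with hq
        · exact Or.inr ⟨⟨⟨k, hk'⟩, by omega⟩, ⟨k, hk⟩, hq⟩
        · exact Or.inl ⟨⟨k, hk'⟩, by omega⟩
      refine (measure_mono hsub).trans ((measure_union_le _ _).trans ?_)
      refine (add_le_add (ih (j + 1)) ((hblock _ _ (by positivity)
        (isStopped_quickCount A M n j)).trans (mul_le_mul_right (ih j) _))).trans (le_of_eq ?_)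
      ring

/-- If no `timeR c` is infinite with positive probability, the speed is at most `0`. -/
lemma ae_limsup_le_zero {d : ℕ} [NeZero d] {r : ℕ} {P : Measure (Env d)} [IsProbabilityMeasure P]
    (hstat : IsStationary P) (hmix : MixingCondition r P)
    (hR : ∀ c : ℕ, 1 ≤ c → pathLaw P 0 {X : ℕ → Site d | timeR (c : ℝ) X = ⊤} = 0) :
    ∀ᵐ X ∂(pathLaw P (0 : Site d)),
      ¬ 0 < limsup (fun n : ℕ => (((X n 0 : ℝ) / (n : ℝ) : ℝ) : EReal)) atTop := by
  have hslow : ∀ A : ℕ, ∀ᵐ X ∂(pathLaw P (0 : Site d)), 1 ≤ A → ∃ M : ℕ, 1 ≤ M ∧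
      ∀ᶠ n in atTop, ¬ ((∃ k, ((n * M : ℕ) : ℤ) ≤ X k 0) ∧ (n + 1) / 2 ≤ quickCount A M n X) := by
    intro A
    rcases Nat.eq_zero_or_pos A with rfl | hA
    · simp
    obtain ⟨M, hM, hblock⟩ := exists_block hstat hmix hA (hR _ (by omega))
    have hsum : ∑' n : ℕ, pathLaw P 0 {X : ℕ → Site d | (∃ k, ((n * M : ℕ) : ℤ) ≤ X k 0) ∧
        (n + 1) / 2 ≤ quickCount A M n X} ≠ ∞ := by
      refine ne_top_of_le_ne_top (b := ∑' n : ℕ, (2⁻¹ : ℝ≥0∞) ^ n) ?_ ?_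
      · rw [ENNReal.tsum_geometric]
        simp
      -- `(n + 1) / 2` is `n/2` rounded up, so `16⁻¹` to this power is at most `4⁻¹ ^ n` and the
      -- bound becomes `2⁻¹ ^ n`.
      · refine ENNReal.tsum_le_tsum fun n => (pathLaw_quickCount_le hblock n _).trans ?_
        have h16 : (16 : ℝ≥0∞)⁻¹ = 4⁻¹ ^ 2 := by
          rw [← ENNReal.inv_pow]; norm_num
        have h2 : (2 : ℝ≥0∞)⁻¹ = 2 * 4⁻¹ := by
          rw [show (4 : ℝ≥0∞) = 2 * 2 by norm_num, ENNReal.mul_inv (by simp) (by simp),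
            ← mul_assoc, ENNReal.mul_inv_cancel (by simp) (by simp), one_mul]
        rw [h16, ← pow_mul, h2, mul_pow]
        refine mul_le_mul_right (pow_le_pow_of_le_one zero_le ?_ (by omega)) _
        exact ENNReal.inv_le_one.2 (by norm_num)
    filter_upwards [ae_eventually_notMem hsum] with X hX _
    exact ⟨M, hM, hX⟩
  filter_upwards [ae_all_iff.2 hslow] with X hX hpos
  obtain ⟨q, hq0, hq⟩ := EReal.lt_iff_exists_real_btwn.1 hpos
  have hq0' : 0 < q := by exact_mod_cast hq0
  have hfreq := frequently_lt_of_lt_limsup (by isBoundedDefault) hq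
  -- If `X t 0 > q t`, the walk has reached level `n M` by time `t`, where `q t < (n + 1) M ≤ 2 n
  -- M`. With `A q ≥ 4` this gives `2 t ≤ n A M`, so at least half of the `n` blocks were quick.
  set A := ⌈4 / q⌉₊ with hA
  have hA1 : 1 ≤ A := Nat.ceil_pos.2 (by positivity)
  have hAq : 4 ≤ A * q := by
    have := Nat.le_ceil (4 / q)
    rwa [div_le_iff₀ hq0'] at this
  obtain ⟨M, hM, hev⟩ := hX A hA1
  obtain ⟨n₀, hn₀⟩ := eventually_atTop.1 hev
  obtain ⟨t₀, ht₀⟩ := exists_nat_gt (((n₀ + 1 : ℕ) + 1) * M / q : ℝ)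
  obtain ⟨t, ht, hXt⟩ := (frequently_atTop.1 hfreq) (t₀ + 1)
  have ht1 : (0 : ℝ) < t := by exact_mod_cast (by omega : 0 < t)
  have hXt' : q * t < X t 0 := by
    have : q < (X t 0 : ℝ) / t := by exact_mod_cast hXt
    rwa [lt_div_iff₀ ht1] at this
  have hZ0 : 0 ≤ X t 0 := by
    have : (0 : ℝ) < X t 0 := lt_trans (by positivity) hXt'
    exact_mod_cast this.le
  obtain ⟨Z, hZ⟩ := Int.eq_ofNat_of_zero_le hZ0
  rw [hZ, Int.cast_natCast] at hXt'
  set n := Z / M with hn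
  have hnM : n * M ≤ Z := Nat.div_mul_le_self Z M
  have hnM' : Z < (n + 1) * M := by
    rw [add_mul, one_mul, mul_comm]
    exact Nat.lt_mul_div_succ Z hM |>.trans_eq (by ring)
  -- One more than `n₀`, so that also `n ≥ 1`, as `n + 1 ≤ 2 n` requires.
  have hnlarge : n₀ + 1 ≤ n := by
    refine (Nat.le_div_iff_mul_le hM).2 ?_
    have h1 : (((n₀ + 1 : ℕ) + 1) * M : ℝ) < q * t := by
      rw [div_lt_iff₀ hq0'] at ht₀
      have : (t₀ : ℝ) ≤ t := by exact_mod_cast (by omega : t₀ ≤ t)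
      nlinarith
    have h2 : (((n₀ + 1) * M : ℕ) : ℝ) ≤ Z := by
      push_cast at h1 ⊢
      have : (0 : ℝ) ≤ M := Nat.cast_nonneg _
      nlinarith
    exact_mod_cast h2
  have hhit : ((n * M : ℕ) : ℤ) ≤ X t 0 := by
    rw [hZ]
    exact_mod_cast hnM
  refine hn₀ n (by omega) ⟨⟨t, hhit⟩, ?_⟩
  have hT : hitTime ((n * M : ℕ) : ℤ) X ≤ t := hitTime_le hhit
  have hcount := mul_le_hitTime_add_quickCount A M n X ⟨t, hhit⟩
  have h2t : 2 * t ≤ n * (A * M) := by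
    have h1 : (Z : ℝ) < (n + 1) * M := by exact_mod_cast hnM'
    have h2 : ((n : ℝ) + 1) * M ≤ 2 * (n * M) := by
      have : (1 : ℝ) ≤ n := by exact_mod_cast (by omega : 1 ≤ n)
      have : (0 : ℝ) ≤ M := Nat.cast_nonneg _
      nlinarith
    have h3 : q * t < 2 * (n * M) := by linarith
    have h4 : (2 * t : ℝ) ≤ n * (A * M) := by
      have h5 : 4 * t ≤ A * q * t := mul_le_mul_of_nonneg_right hAq ht1.le
      have h6 : (A : ℝ) * (q * t) ≤ A * (2 * (n * M)) :=
        mul_le_mul_of_nonneg_left h3.le (Nat.cast_nonneg _)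
      nlinarith
    exact_mod_cast h4
  have hAM : 0 < A * M := Nat.mul_pos hA1 hM
  have h5 : n * (A * M) ≤ (2 * quickCount A M n X) * (A * M) := by
    have : 2 * (n * (A * M)) ≤ n * (A * M) + (2 * quickCount A M n X) * (A * M) := by
      calc 2 * (n * (A * M)) ≤ 2 * (t + quickCount A M n X * (A * M)) := by omega
        _ = 2 * t + (2 * quickCount A M n X) * (A * M) := by ring
        _ ≤ _ := Nat.add_le_add_right h2t _
    omega
  have := Nat.le_of_mul_le_mul_right h5 hAM
  omega

end RWRE

theorem mainTheorem2 (d : ℕ) [NeZero d] (P : MeasureTheory.Measure (RWRE.Env d))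
    [MeasureTheory.IsProbabilityMeasure P]
    (hstat : RWRE.IsStationary P) (hell : RWRE.IsUniformlyElliptic P)
    (r : ℕ) (hr : 1 ≤ r) (hmarkov : RWRE.IsRMarkov r P) (hmix : RWRE.MixingCondition r P)
    (hpos : 0 < RWRE.annealedLaw P 0
      {p | 0 < Filter.limsup (fun n : ℕ => (((p.2 n 0 : ℝ) / (n : ℝ) : ℝ) : EReal))
        Filter.atTop}) :
    ∃ c₅ : ℝ, 0 < c₅ ∧ 0 < RWRE.annealedLaw P 0 {p | RWRE.timeR c₅ p.2 = ⊤} := by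
  by_contra hcon
  push Not at hcon
  have hR : ∀ c : ℕ, 1 ≤ c →
      RWRE.pathLaw P 0 {X : ℕ → RWRE.Site d | RWRE.timeR (c : ℝ) X = ⊤} = 0 := by
    intro c hc
    have h := hcon c (by exact_mod_cast hc)
    rw [← RWRE.annealedLaw_snd P 0 (RWRE.measurableSet_timeR_eq_top c)]
    exact le_antisymm h zero_le
  have hae := RWRE.ae_limsup_le_zero hstat hmix hR
  rw [RWRE.pathLaw, ← Measure.snd_compProd] at hae
  -- The null set is pulled back from the path marginal to the joint law, so measurability of the
  -- `limsup` event is not needed.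
  have hae' := ae_of_ae_map measurable_snd.aemeasurable hae
  refine hpos.ne' ?_
  rw [ae_iff] at hae'
  simp only [not_not] at hae'
  exact hae'
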